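/- Let $X$ be a CAT(0) space, let $\kappa:[0,\infty)\to[1,\infty)$ be nondecreasing and concave with $\lim_{t\to\infty}\kappa(t)/t=0$, and let $b:[0,\infty)\to X$ be a geodesic ray. For $x\in X$ put $\kappa(x)=\kappa(d(b(0),x))$, and let $\pi_\gamma$ denote nearest-point projection to (the image of) a geodesic $\gamma$. The ray $b$ is *$\kappa$-contracting* if there is $C\ge 0$ such that $\operatorname{diam}\pi_b(B)<C\,\kappa(x)$ for every $x\in X$ and every ball $B$ centred at $x$ that is disjoint from $b$. If $\gamma:I\to X$ is a geodesic, $I$ a closed interval, and $[r-\frac12,r+\frac12]\subset\operatorname{int} I$, the *curtain* dual to $\gamma$ at $r$ is $h=\pi_\gamma^{-1}(\gamma[r-\frac12,r+\frac12])$; its half-spaces are $h^-=\pi_\gamma^{-1}(\gamma(I\cap(-\infty,r-\frac12)))$ and $h^+=\pi_\gamma^{-1}(\gamma(I\cap(r+\frac12,\infty)))$, and $h$ *separates* two sets if they lie in different half-spaces of $h$. A *chain* is a finite or infinite sequence of pairwise disjoint curtains $h_i$ such that $h_i$ separates $h_{i-1}$ from $h_{i+1}$ whenever these are defined. Disjoint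 curtains $h,h'$ are *$L$-separated* if every chain, all of whose members meet both $h$ and $h'$, has at most $L$ members. A *$\kappa$-chain meeting $b$ at the points $b(t_i)$*, with constant $C>0$, is an infinite chain of curtains $(h_i)_{i\ge 0}$ with times $t_i\ge 0$ such that, for all $i$, $b(t_i)\in h_i$, $t_{i+1}-t_i\le C\kappa(t_{i+1})$, and $h_i,h_{i+1}$ are $C\kappa(t_{i+1})$-separated. The ray $b$ is *$\kappa$-curtain-excursion* if for some $C>0$ there is such a $\kappa$-chain with each $h_i$ the curtain dual to $b$ at $t_i$. Then: (1) $b$ is $\kappa$-contracting if and only if, for some $C>0$, it meets a $\kappa$-chain with constant $C$ (the curtains not necessarily dual to $b$); and (2) $b$ is $\kappa$-contracting if and only if it is $\kappa$-curtain-excursion. -/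

import Mathlib

open Set Filter Topology

/-! ## Geodesics and CAT(0) spaces -/

/-- `γ`, restricted to `I ⊆ ℝ`, is an isometric embedding. When `I` is an interval, `γ` is a
geodesic with domain `I`; values of `γ` outside `I` are irrelevant. -/
def IsGeodesicOn {X : Type*} [MetricSpace X] (γ : ℝ → X) (I : Set ℝ) : Prop :=
  ∀ s ∈ I, ∀ t ∈ I, dist (γ s) (γ t) = |s - t|

/-- `γ` is a geodesic segment from `x` to `y`, parametrized by arc length on `[0, d(x, y)]`. -/
def IsGeodesicFromTo {X : Type*} [MetricSpace X] (γ : ℝ → X) (x y : X) : Prop :=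
  IsGeodesicOn γ (Icc 0 (dist x y)) ∧ γ 0 = x ∧ γ (dist x y) = y

/-- A geodesic ray `[0, ∞) → X`. -/
def IsGeodesicRay {X : Type*} [MetricSpace X] (b : ℝ → X) : Prop :=
  IsGeodesicOn b (Ici 0)

/-- CAT(0) spaces: geodesic metric spaces in which every geodesic triangle is at least as thin as
its comparison triangle in the Euclidean plane. Here `x` is the common vertex of the two sides on
which the two compared points lie (any two sides of a triangle share a vertex, and for two points
on the same side there is nothing to compare), and `x'`, `y'`, `z'`, `p'`, `q'` are the comparison
points. -/
structure IsCAT0 (X : Type*) [MetricSpace X] : Prop where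
  exists_geodesic : ∀ x y : X, ∃ γ : ℝ → X, IsGeodesicFromTo γ x y
  comparison : ∀ (x y z : X) (γ δ : ℝ → X), IsGeodesicFromTo γ x y → IsGeodesicFromTo δ x z →
    ∀ x' y' z' : EuclideanSpace ℝ (Fin 2),
      dist x' y' = dist x y → dist x' z' = dist x z → dist y' z' = dist y z →
    ∀ s ∈ Icc 0 (dist x y), ∀ t ∈ Icc 0 (dist x z), ∀ p' q' : EuclideanSpace ℝ (Fin 2),
      dist x' p' = dist x (γ s) → dist p' y' = dist (γ s) y →
      dist x' q' = dist x (δ t) → dist q' z' = dist (δ t) z →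
      dist (γ s) (δ t) ≤ dist p' q'

/-! ## Nearest-point projection -/

/-- `p` is a closest point to `x` in `S`. (In a CAT(0) space, for `S` the image of a geodesic with
closed domain, there is exactly one such `p`, namely `π_S(x)`.) -/
def IsNearestPoint {X : Type*} [MetricSpace X] (S : Set X) (x p : X) : Prop :=
  p ∈ S ∧ ∀ q ∈ S, dist x p ≤ dist x q

/-- The image `π_S(B)` of `B` under nearest-point projection to `S`. -/
def projImage {X : Type*} [MetricSpace X] (S B : Set X) : Set X :=
  {p | ∃ x ∈ B, IsNearestPoint S x p}

/-! ## Sublinear functions and contracting rays -/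

/-- Sublinear functions `κ : [0, ∞) → [1, ∞)`, taken monotone and concave. -/
structure IsSublinear (κ : ℝ → ℝ) : Prop where
  one_le : ∀ t, 0 ≤ t → 1 ≤ κ t
  monotone : MonotoneOn κ (Ici 0)
  concave : ConcaveOn ℝ (Ici 0) κ
  tendsto : Tendsto (fun t => κ t / t) atTop (𝓝 0)

/-- The ray `b` is `κ`-contracting: for some `C ≥ 0`, every ball `B` centred at any `x` and
disjoint from `b` satisfies `diam (π_b(B)) < C κ(x)`, where `κ(x) = κ(d(𝔬, x))` and `𝔬 = b(0)`. -/
def IsKappaContracting {X : Type*} [MetricSpace X] (κ : ℝ → ℝ) (b : ℝ → X) : Prop :=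
  ∃ C : ℝ, 0 ≤ C ∧ ∀ (x : X) (R : ℝ), Disjoint (Metric.ball x R) (b '' Ici 0) →
    Metric.ediam (projImage (b '' Ici 0) (Metric.ball x R)) <
      ENNReal.ofReal (C * κ (dist (b 0) x))

/-! ## Curtains and chains -/

/-- The data defining a curtain: a geodesic `γ` whose domain `I` is a closed interval (bounded or
not) and a number `r` with `[r - 1/2, r + 1/2]` in the interior of `I`. -/
structure Curtain (X : Type*) [MetricSpace X] where
  γ : ℝ → X
  I : Set ℝ
  r : ℝ
  isClosed : IsClosed I
  ordConnected : I.OrdConnected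
  isGeodesic : IsGeodesicOn γ I
  subset_interior : Icc (r - 1 / 2) (r + 1 / 2) ⊆ interior I

namespace Curtain

variable {X : Type*} [MetricSpace X]

/-- The curtain as a subset of `X`: the preimage of the pole under projection to the geodesic. -/
def carrier (h : Curtain X) : Set X :=
  {x | ∃ s ∈ Icc (h.r - 1 / 2) (h.r + 1 / 2), IsNearestPoint (h.γ '' h.I) x (h.γ s)}

/-- The half-space of points projecting before the pole. -/
def neg (h : Curtain X) : Set X :=
  {x | ∃ s ∈ h.I, s < h.r - 1 / 2 ∧ IsNearestPoint (h.γ '' h.I) x (h.γ s)}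

/-- The half-space of points projecting after the pole. -/
def pos (h : Curtain X) : Set X :=
  {x | ∃ s ∈ h.I, h.r + 1 / 2 < s ∧ IsNearestPoint (h.γ '' h.I) x (h.γ s)}

/-- `h` separates `A` from `B`: they lie in different half-spaces of `h`. (Which of the two is
called `h⁻` depends only on the orientation of the geodesic.) -/
def Separates (h : Curtain X) (A B : Set X) : Prop :=
  (A ⊆ h.neg ∧ B ⊆ h.pos) ∨ (A ⊆ h.pos ∧ B ⊆ h.neg)

/-- `h` is the curtain `h_{b,r}` dual to the ray `b : [0, ∞) → X` at `r`; the centre of its pole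
is `b(r)`. -/
def IsDualTo (h : Curtain X) (b : ℝ → X) (r : ℝ) : Prop :=
  h.I = Ici 0 ∧ EqOn h.γ b (Ici 0) ∧ h.r = r

/-- The curtains `h i`, `i < N`, form a chain (`N = ⊤` is an infinite chain `h 0, h 1, …`): they
are pairwise disjoint, and each separates its predecessor from its successor. The cardinality of
the chain is `N`. -/
def IsChainOfLength (N : ℕ∞) (h : ℕ → Curtain X) : Prop :=
  (∀ i j : ℕ, (i : ℕ∞) < N → (j : ℕ∞) < N → i ≠ j → Disjoint (h i).carrier (h j).carrier) ∧
  (∀ i : ℕ, ((i + 2 : ℕ) : ℕ∞) < N →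
    (h (i + 1)).Separates (h i).carrier (h (i + 2)).carrier)

/-- Disjoint curtains `h`, `h'` are `L`-separated: every chain of curtains all of which meet both
`h` and `h'` is finite, of cardinality at most `L`. -/
def LSeparated (L : ℝ) (h h' : Curtain X) : Prop :=
  Disjoint h.carrier h'.carrier ∧
  ∀ (N : ℕ∞) (k : ℕ → Curtain X), IsChainOfLength N k →
    (∀ i : ℕ, (i : ℕ∞) < N → ((k i).carrier ∩ h.carrier).Nonempty ∧
      ((k i).carrier ∩ h'.carrier).Nonempty) →
    ∃ n : ℕ, N = n ∧ (n : ℝ) ≤ L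

/-- The infinite sequence of curtains `h` is a `κ`-chain meeting `b` at the points `b(t i)`, with
excursion constant `C`. -/
structure IsKappaChain (κ : ℝ → ℝ) (C : ℝ) (b : ℝ → X) (h : ℕ → Curtain X) (t : ℕ → ℝ) :
    Prop where
  chain : IsChainOfLength ⊤ h
  nonneg : ∀ i, 0 ≤ t i
  meets : ∀ i, b (t i) ∈ (h i).carrier
  gap : ∀ i, t (i + 1) - t i ≤ C * κ (t (i + 1))
  separated : ∀ i, LSeparated (C * κ (t (i + 1))) (h i) (h (i + 1))

/-- `b` is a `κ`-curtain-excursion ray: there is a `κ`-chain of curtains dual to `b`, the `i`-th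
one with pole centred at `b(t i)`. -/
def IsKappaCurtainExcursion (κ : ℝ → ℝ) (b : ℝ → X) : Prop :=
  ∃ C : ℝ, 0 < C ∧ ∃ (h : ℕ → Curtain X) (t : ℕ → ℝ),
    IsKappaChain κ C b h t ∧ ∀ i, (h i).IsDualTo b (t i)

end Curtain

/-! It suffices to show that contracting rays are curtain-excursion and that a ray meeting a
`κ`-chain is contracting; a chain of dual curtains is already a `κ`-chain. Each curtain is handled
through a wall, a `1`-Lipschitz function with connected preimages of intervals, so that separation
arguments become applications of the intermediate value theorem.

Contracting implies curtain-excursion. Put `H = M κ(t)` with `M` large, and place dual curtains at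
`t` and `t + 6H`. A curtain meeting both contains a path made of two perpendiculars to its pole and
a piece of the pole of length at most `1`, so one perpendicular projects across an interval of `b`
of length `2H`. Near `b(t)` balls missing `b` have projections much smaller than `H`, which forces
that perpendicular to come within `5H` of `b` (`exists_height_lt`). Otherwise let `m` be its point
closest to `b`, and slide `m` and a suitable endpoint down to height `H`. The geodesic between the
two lowered points dips towards `b` near both ends (`exists_dip`), so the segment from `m` to the
endpoint starts out nearly along the perpendicular from `m` and loses height, contradicting
minimality. Hence every chain crossing both dual curtains has representatives in a set of diameter
`16H`. Crossing curtains costs length, so the chain has at most `16H + 4` members.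

Meeting a `κ`-chain implies contracting. If the projections of `u` and `v` to `b` are far apart,
three consecutive curtains of the chain cut `[u, v]` in between (`exists_between`). Its point `z` on
the middle one is close to `b`: all of `b` projects to the foot of the perpendicular from `z`, while
one of the outer crossing points projects to `z`. Thus two `L`-separated curtains both project over
the whole perpendicular, whose length is then at most `2L + 4` by `LSeparated.overlap_le`. So `[u,
v]` passes near `b`, and no ball about one end that misses `b` contains the other. -/

/-! ## Comparison inequalities in CAT(0) spaces -/

/-- Three nonnegative reals satisfying the triangle inequalities are the side lengths of a
triangle in the Euclidean plane with one vertex at the origin. -/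
theorem exists_euclidean_triangle {a b c : ℝ} (ha : 0 ≤ a) (hb : 0 ≤ b) (hc : 0 ≤ c)
    (h1 : a ≤ b + c) (h2 : b ≤ a + c) (h3 : c ≤ a + b) :
    ∃ v w : EuclideanSpace ℝ (Fin 2), ‖v‖ = a ∧ ‖w‖ = b ∧ ‖v - w‖ = c := by
  have key : ∀ (u : EuclideanSpace ℝ (Fin 2)) (r : ℝ), 0 ≤ r → u 0 ^ 2 + u 1 ^ 2 = r ^ 2 →
      ‖u‖ = r := by
    intro u r hr h
    rw [EuclideanSpace.norm_eq, Fin.sum_univ_two]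
    simp only [Real.norm_eq_abs, sq_abs]
    rw [h, Real.sqrt_sq hr]
  rcases ha.eq_or_lt with h0 | h0
  · subst h0
    have hbc : b = c := by linarith
    subst hbc
    exact ⟨!₂[0, 0], !₂[b, 0], key _ _ le_rfl (by simp), key _ _ hb (by simp),
      key _ _ hb (by simp)⟩
  · set p : ℝ := (a ^ 2 + b ^ 2 - c ^ 2) / (2 * a) with hp
    have hpa : 2 * a * p = a ^ 2 + b ^ 2 - c ^ 2 := by rw [hp]; field_simp
    have hnn : 0 ≤ b ^ 2 - p ^ 2 := by
      -- Heron's formula: the triangle inequalities make the squared altitude nonnegative.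
      have e : 4 * a ^ 2 * (b ^ 2 - p ^ 2) = (c - a + b) * (c + a - b) * (a + b - c) * (a + b + c) := by
        have : 4 * a ^ 2 * p ^ 2 = (a ^ 2 + b ^ 2 - c ^ 2) ^ 2 := by rw [← hpa]; ring
        linear_combination -this
      have : 0 ≤ (c - a + b) * (c + a - b) * (a + b - c) * (a + b + c) := by
        have := mul_nonneg (mul_nonneg (mul_nonneg (show 0 ≤ c - a + b by linarith)
          (show 0 ≤ c + a - b by linarith)) (show 0 ≤ a + b - c by linarith))
          (show 0 ≤ a + b + c by linarith)
        exact this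
      rw [← e] at this
      exact nonneg_of_mul_nonneg_right this (by positivity)
    have hs := Real.sq_sqrt hnn
    refine ⟨!₂[a, 0], !₂[p, √(b ^ 2 - p ^ 2)], key _ _ ha (by simp), key _ _ hb ?_, key _ _ hc ?_⟩
    · simp [hs]
    · simp [hs]
      linear_combination -hpa

section

variable {X : Type*} [MetricSpace X]

theorem IsGeodesicFromTo.dist_left {γ : ℝ → X} {x y : X} (h : IsGeodesicFromTo γ x y) {s : ℝ}
    (hs : s ∈ Icc 0 (dist x y)) : dist x (γ s) = s := by
  obtain ⟨hg, h0, h1⟩ := h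
  have := hg 0 ⟨le_rfl, dist_nonneg⟩ s hs
  rw [h0] at this
  rw [this, zero_sub, abs_neg, abs_of_nonneg hs.1]

theorem IsGeodesicFromTo.dist_right {γ : ℝ → X} {x y : X} (h : IsGeodesicFromTo γ x y) {s : ℝ}
    (hs : s ∈ Icc 0 (dist x y)) : dist (γ s) y = dist x y - s := by
  obtain ⟨hg, h0, h1⟩ := h
  have := hg s hs _ ⟨dist_nonneg, le_rfl⟩
  rw [h1] at this
  rw [this, abs_sub_comm, abs_of_nonneg (by linarith [hs.2])]

/-- `p` divides a geodesic from `x` to `y` in the ratio `l : (1 - l)`. -/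
structure DividesAt (l : ℝ) (x y p : X) : Prop where
  nonneg : 0 ≤ l
  le_one : l ≤ 1
  dist_left : dist x p = l * dist x y
  dist_right : dist p y = (1 - l) * dist x y

theorem DividesAt.one (x y : X) : DividesAt 1 x y y := ⟨zero_le_one, le_rfl, by simp, by simp⟩

theorem DividesAt.exists_of_dist {x y p : X} (h : dist x p + dist p y = dist x y) :
    ∃ l, DividesAt l x y p := by
  rcases eq_or_lt_of_le (dist_nonneg (x := x) (y := y)) with h0 | h0
  · have a := dist_nonneg (x := x) (y := p)
    have b := dist_nonneg (x := p) (y := y)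
    exact ⟨0, le_rfl, zero_le_one, by linarith, by linarith⟩
  · refine ⟨dist x p / dist x y, by positivity, ?_, ?_, ?_⟩
    · rw [div_le_one h0]; linarith [dist_nonneg (x := p) (y := y)]
    · field_simp
    · field_simp; linarith

theorem IsGeodesicFromTo.dividesAt {γ : ℝ → X} {x y : X} (h : IsGeodesicFromTo γ x y) {l : ℝ}
    (h0 : 0 ≤ l) (h1 : l ≤ 1) : DividesAt l x y (γ (l * dist x y)) := by
  have hd := dist_nonneg (x := x) (y := y)
  have hm : l * dist x y ∈ Icc 0 (dist x y) := ⟨by positivity, mul_le_of_le_one_left hd h1⟩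
  exact ⟨h0, h1, h.dist_left hm, by rw [h.dist_right hm]; ring⟩

namespace IsCAT0

variable (hX : IsCAT0 X)
include hX

theorem exists_dividesAt (x y : X) {l : ℝ} (h0 : 0 ≤ l) (h1 : l ≤ 1) :
    ∃ p, DividesAt l x y p := by
  obtain ⟨γ, hγ⟩ := hX.exists_geodesic x y
  exact ⟨_, hγ.dividesAt h0 h1⟩

theorem sq_dist_geodesic_le {x y z : X} {γ δ : ℝ → X} (hγ : IsGeodesicFromTo γ x y)
    (hδ : IsGeodesicFromTo δ x z) {l m : ℝ} (hl0 : 0 ≤ l) (hl1 : l ≤ 1) (hm0 : 0 ≤ m)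
    (hm1 : m ≤ 1) :
    dist (γ (l * dist x y)) (δ (m * dist x z)) ^ 2 ≤ l ^ 2 * dist x y ^ 2 + m ^ 2 * dist x z ^ 2
      - l * m * (dist x y ^ 2 + dist x z ^ 2 - dist y z ^ 2) := by
  obtain ⟨v, w, hv, hw, hvw⟩ := exists_euclidean_triangle (dist_nonneg (x := x) (y := y))
    (dist_nonneg (x := x) (y := z)) (dist_nonneg (x := y) (y := z))
    (by linarith [dist_triangle x z y, dist_comm y z]) (dist_triangle x y z)
    (by linarith [dist_triangle y x z, dist_comm x y])
  have h1 := hγ.dividesAt hl0 hl1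
  have h2 := hδ.dividesAt hm0 hm1
  have hxy := dist_nonneg (x := x) (y := y)
  have hxz := dist_nonneg (x := x) (y := z)
  have e1 : dist (l • v) v = (1 - l) * dist x y := by
    have : l • v - v = -((1 - l) • v) := by rw [sub_smul, one_smul]; abel
    rw [dist_eq_norm, this, norm_neg, norm_smul, hv, Real.norm_of_nonneg (by linarith)]
  have e2 : dist (m • w) w = (1 - m) * dist x z := by
    have : m • w - w = -((1 - m) • w) := by rw [sub_smul, one_smul]; abel
    rw [dist_eq_norm, this, norm_neg, norm_smul, hw, Real.norm_of_nonneg (by linarith)]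
  have key := hX.comparison x y z γ δ hγ hδ 0 v w (by simp [hv]) (by simp [hw])
    (by rw [dist_eq_norm, hvw]) (l * dist x y) ⟨by positivity, mul_le_of_le_one_left hxy hl1⟩
    (m * dist x z) ⟨by positivity, mul_le_of_le_one_left hxz hm1⟩ (l • v) (m • w)
    (by rw [h1.dist_left, dist_zero_left, norm_smul, hv, Real.norm_of_nonneg hl0])
    (by rw [h1.dist_right, e1])
    (by rw [h2.dist_left, dist_zero_left, norm_smul, hw, Real.norm_of_nonneg hm0])
    (by rw [h2.dist_right, e2])
  have e3 := @norm_sub_sq_real _ _ _ v w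
  have e4 := @norm_sub_sq_real _ _ _ (l • v) (m • w)
  rw [real_inner_smul_left, real_inner_smul_right, norm_smul, norm_smul, hv, hw,
    Real.norm_of_nonneg hl0, Real.norm_of_nonneg hm0] at e4
  rw [hv, hw, hvw] at e3
  have := pow_le_pow_left₀ dist_nonneg key 2
  rw [dist_eq_norm (l • v), e4] at this
  refine this.trans (le_of_eq ?_)
  linear_combination (-l * m) * e3

/-- Bruhat–Tits inequality, for a point on a given geodesic. -/
theorem sq_dist_geodesic_le' {x y : X} (z : X) {γ : ℝ → X} (hγ : IsGeodesicFromTo γ x y) {l : ℝ}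
    (hl0 : 0 ≤ l) (hl1 : l ≤ 1) :
    dist (γ (l * dist x y)) z ^ 2 ≤ (1 - l) * dist x z ^ 2 + l * dist y z ^ 2
      - l * (1 - l) * dist x y ^ 2 := by
  obtain ⟨δ, hδ⟩ := hX.exists_geodesic x z
  have := hX.sq_dist_geodesic_le hγ hδ hl0 hl1 zero_le_one le_rfl
  rw [one_mul, hδ.2.2] at this
  linarith

/-- Uniqueness of geodesics: with `p` itself as third vertex, the right side of the Bruhat–Tits
inequality vanishes. -/
theorem eq_of_dividesAt_geodesic {x y p : X} {γ : ℝ → X} (hγ : IsGeodesicFromTo γ x y) {l : ℝ}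
    (hp : DividesAt l x y p) : γ (l * dist x y) = p := by
  have := hX.sq_dist_geodesic_le' p hγ hp.nonneg hp.le_one
  rw [hp.dist_left, dist_comm y p, hp.dist_right] at this
  have h : dist (γ (l * dist x y)) p ^ 2 ≤ 0 := this.trans (le_of_eq (by ring))
  have h2 : dist (γ (l * dist x y)) p = 0 := by
    have := sq_nonneg (dist (γ (l * dist x y)) p)
    exact pow_eq_zero_iff (two_ne_zero) |>.1 (le_antisymm h this)
  exact dist_eq_zero.1 h2

theorem dividesAt_unique {x y p q : X} {l : ℝ} (hp : DividesAt l x y p) (hq : DividesAt l x y q) :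
    p = q := by
  obtain ⟨γ, hγ⟩ := hX.exists_geodesic x y
  rw [← hX.eq_of_dividesAt_geodesic hγ hp, ← hX.eq_of_dividesAt_geodesic hγ hq]

/-- The CAT(0) inequality for two points on two sides of a triangle. -/
theorem sq_dist_le {x y z p q : X} {l m : ℝ} (hp : DividesAt l x y p) (hq : DividesAt m x z q) :
    dist p q ^ 2 ≤ l ^ 2 * dist x y ^ 2 + m ^ 2 * dist x z ^ 2
      - l * m * (dist x y ^ 2 + dist x z ^ 2 - dist y z ^ 2) := by
  obtain ⟨γ, hγ⟩ := hX.exists_geodesic x y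
  obtain ⟨δ, hδ⟩ := hX.exists_geodesic x z
  have := hX.sq_dist_geodesic_le hγ hδ hp.nonneg hp.le_one hq.nonneg hq.le_one
  rwa [hX.eq_of_dividesAt_geodesic hγ hp, hX.eq_of_dividesAt_geodesic hδ hq] at this

/-- The Bruhat–Tits inequality. -/
theorem sq_dist_vertex_le {x y p : X} (z : X) {l : ℝ} (hp : DividesAt l x y p) :
    dist p z ^ 2 ≤ (1 - l) * dist x z ^ 2 + l * dist y z ^ 2 - l * (1 - l) * dist x y ^ 2 := by
  have := hX.sq_dist_le hp (DividesAt.one x z)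
  linarith

theorem dist_vertex_le {x y p : X} (z : X) {l : ℝ} (hp : DividesAt l x y p) :
    dist p z ≤ (1 - l) * dist x z + l * dist y z := by
  have h := hX.sq_dist_vertex_le z hp
  have h0 := hp.nonneg
  have h1 : 0 ≤ 1 - l := by linarith [hp.le_one]
  have t1 := dist_triangle x y z
  have t2 := dist_triangle y x z
  rw [dist_comm y x] at t2
  have hsq : (dist x z - dist y z) ^ 2 ≤ dist x y ^ 2 :=
    sq_le_sq' (by linarith) (by linarith)
  have := mul_le_mul_of_nonneg_left hsq (mul_nonneg h0 h1)
  apply le_of_sq_le_sq _ (by positivity)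
  nlinarith

/-- The sum of the squares of the diagonals of a quadrilateral is at most the sum of the squares
of its sides. -/
theorem quadrilateral (x y p q : X) :
    dist x q ^ 2 + dist y p ^ 2 ≤ dist x p ^ 2 + dist p q ^ 2 + dist q y ^ 2 + dist x y ^ 2 := by
  -- Bruhat–Tits at the midpoint of one diagonal bounds its distances to the ends of the other.
  obtain ⟨m, hm⟩ := hX.exists_dividesAt x q (l := 1 / 2) (by norm_num) (by norm_num)
  have h1 := hX.sq_dist_vertex_le p hm
  have h2 := hX.sq_dist_vertex_le y hm
  have t := dist_triangle y m p
  rw [dist_comm y m] at t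
  have h3 : dist y p ^ 2 ≤ (dist m y + dist m p) ^ 2 := pow_le_pow_left₀ dist_nonneg t 2
  rw [dist_comm q p] at h1
  nlinarith [sq_nonneg (dist m y - dist m p)]

/-- If the distance to `x` grows at rate at least `ρ` on an initial piece of a geodesic from `z`
to `m`, it does so on the whole geodesic. -/
theorem le_dist_of_dividesAt {x z m w : X} {l ρ : ℝ} (hw : DividesAt l z m w) (hl : 0 < l)
    (h : dist x z + ρ * dist z w ≤ dist x w) : dist x z + ρ * dist z m ≤ dist x m := by
  have := hX.dist_vertex_le x hw
  rw [hw.dist_left] at h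
  rw [dist_comm w x, dist_comm z x, dist_comm m x] at this
  have : l * (dist x z + ρ * dist z m) ≤ l * dist x m := by linarith
  exact le_of_mul_le_mul_left this hl

/-- Two points at the same distance from a vertex with small comparison angle are close. -/
theorem dist_le_of_hinge {m y z p q : X} {l k c : ℝ} (hp : DividesAt l m y p)
    (hq : DividesAt k m z q) (hpq : dist m p = dist m q) (hc : 0 ≤ c)
    (h : (dist y z + dist m y - dist m z) * (dist y z + dist m z - dist m y) ≤
      c ^ 2 * (dist m y * dist m z)) : dist p q ≤ c * dist m p := by
  -- The product in `h` is `d(y,z)² - (d(m,y) - d(m,z))²`, that is `2 d(m,y) d(m,z) (1 - cos θ)`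
  -- with `θ` the comparison angle at `m`.
  have key := hX.sq_dist_le hp hq
  have h1 := hp.dist_left
  have h2 : dist m p = k * dist m z := hpq.trans hq.dist_left
  have hlk : 0 ≤ l * k := mul_nonneg hp.nonneg hq.nonneg
  have := mul_le_mul_of_nonneg_left h hlk
  apply le_of_sq_le_sq _ (by positivity)
  have e : (c * dist m p) ^ 2 = c ^ 2 * (l * dist m y * (k * dist m z)) := by
    rw [← h1, ← h2]; ring
  rw [e]
  have e2 : l ^ 2 * dist m y ^ 2 = l * dist m y * (k * dist m z) := by
    rw [← h2, h1]; ring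
  have e3 : k ^ 2 * dist m z ^ 2 = l * dist m y * (k * dist m z) := by
    rw [← h1, h2]; ring
  rw [e2, e3] at key
  nlinarith

end IsCAT0

/-! ## Nearest-point projection to a geodesic -/

/-- `γ` is a geodesic whose domain is the nonempty closed interval `I`. -/
structure IsClosedGeodesic (γ : ℝ → X) (I : Set ℝ) : Prop where
  isGeodesic : IsGeodesicOn γ I
  isClosed : IsClosed I
  ordConnected : I.OrdConnected
  nonempty : I.Nonempty

/-- The parameter of the point of the geodesic `γ` closest to `x`. -/
noncomputable def footParam (γ : ℝ → X) (I : Set ℝ) (x : X) : ℝ :=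
  Classical.epsilon fun s => s ∈ I ∧ IsNearestPoint (γ '' I) x (γ s)

theorem IsGeodesicOn.continuousOn {γ : ℝ → X} {I : Set ℝ} (h : IsGeodesicOn γ I) :
    ContinuousOn γ I := by
  refine LipschitzOnWith.continuousOn (K := 1) (LipschitzOnWith.of_dist_le_mul fun s hs t ht => ?_)
  rw [h s hs t ht, Real.dist_eq]; simp

namespace IsClosedGeodesic

variable {γ : ℝ → X} {I : Set ℝ}

theorem exists_foot (hγ : IsClosedGeodesic γ I) (x : X) :
    ∃ s ∈ I, IsNearestPoint (γ '' I) x (γ s) := by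
  obtain ⟨s₀, hs₀⟩ := hγ.nonempty
  set K := I ∩ Icc (s₀ - 2 * dist x (γ s₀)) (s₀ + 2 * dist x (γ s₀)) with hK
  have hKc : IsCompact K := isCompact_Icc.inter_left hγ.isClosed
  have hd := dist_nonneg (x := x) (y := γ s₀)
  have hsK : s₀ ∈ K := ⟨hs₀, by constructor <;> linarith⟩
  have hcont : ContinuousOn (fun s => dist x (γ s)) K :=
    (continuous_const.dist continuous_id).comp_continuousOn
      (hγ.isGeodesic.continuousOn.mono inter_subset_left)
  obtain ⟨s, hs, hmin⟩ := hKc.exists_isMinOn ⟨s₀, hsK⟩ hcont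
  refine ⟨s, hs.1, mem_image_of_mem _ hs.1, ?_⟩
  rintro _ ⟨t, ht, rfl⟩
  by_cases htK : t ∈ K
  · exact hmin htK
  · have h1 : dist x (γ s) ≤ dist x (γ s₀) := hmin hsK
    have h2 : 2 * dist x (γ s₀) < |t - s₀| := by
      by_contra hcon
      push Not at hcon
      rw [abs_le] at hcon
      exact htK ⟨ht, by constructor <;> linarith⟩
    have h3 := hγ.isGeodesic t ht s₀ hs₀
    have h4 := dist_triangle_left (γ t) (γ s₀) x
    linarith

theorem footParam_spec (hγ : IsClosedGeodesic γ I) (x : X) :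
    footParam γ I x ∈ I ∧ IsNearestPoint (γ '' I) x (γ (footParam γ I x)) :=
  Classical.epsilon_spec (p := fun s => s ∈ I ∧ IsNearestPoint (γ '' I) x (γ s))
    (hγ.exists_foot x)

theorem footParam_mem (hγ : IsClosedGeodesic γ I) (x : X) : footParam γ I x ∈ I :=
  (hγ.footParam_spec x).1

theorem dist_footParam_le (hγ : IsClosedGeodesic γ I) (x : X) {s : ℝ} (hs : s ∈ I) :
    dist x (γ (footParam γ I x)) ≤ dist x (γ s) :=
  (hγ.footParam_spec x).2.2 _ (mem_image_of_mem _ hs)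

theorem mem_of_dividesAt (hX : IsCAT0 X) (hγ : IsClosedGeodesic γ I) {s t l : ℝ} (hs : s ∈ I)
    (ht : t ∈ I) {p : X} (hp : DividesAt l (γ s) (γ t) p) : ∃ r ∈ I, p = γ r := by
  have h0 := hp.nonneg
  have h1 := hp.le_one
  have hst := hγ.isGeodesic s hs t ht
  have hr : (1 - l) * s + l * t ∈ I := by
    have := hγ.ordConnected.convex hs ht (a := 1 - l) (b := l) (by linarith) h0 (by ring)
    simpa using this
  refine ⟨_, hr, hX.dividesAt_unique hp ⟨h0, h1, ?_, ?_⟩⟩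
  · rw [hγ.isGeodesic _ hs _ hr, hst, show s - ((1 - l) * s + l * t) = l * (s - t) by ring,
      abs_mul, abs_of_nonneg h0]
  · rw [hγ.isGeodesic _ hr _ ht, hst, show (1 - l) * s + l * t - t = (1 - l) * (s - t) by ring,
      abs_mul, abs_of_nonneg (by linarith : 0 ≤ 1 - l)]

/-- The angle at the foot of a perpendicular is at least `π / 2`. -/
theorem sq_dist_ge (hX : IsCAT0 X) (hγ : IsClosedGeodesic γ I) {x : X} {s t : ℝ} (hs : s ∈ I)
    (hx : IsNearestPoint (γ '' I) x (γ s)) (ht : t ∈ I) :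
    dist x (γ s) ^ 2 + dist (γ s) (γ t) ^ 2 ≤ dist x (γ t) ^ 2 := by
  by_contra! hcon
  have key : ∀ l : ℝ, 0 < l → l ≤ 1 →
      (1 - l) * dist (γ s) (γ t) ^ 2 ≤ dist x (γ t) ^ 2 - dist x (γ s) ^ 2 := by
    intro l h0 h1
    obtain ⟨p, hp⟩ := hX.exists_dividesAt (γ s) (γ t) h0.le h1
    obtain ⟨r, hr, rfl⟩ := hγ.mem_of_dividesAt hX hs ht hp
    have h2 := hX.sq_dist_vertex_le x hp
    have h3 := pow_le_pow_left₀ dist_nonneg (hx.2 _ (mem_image_of_mem γ hr)) 2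
    rw [dist_comm _ x, dist_comm _ x, dist_comm _ x] at h2
    have : l * ((1 - l) * dist (γ s) (γ t) ^ 2) ≤ l * (dist x (γ t) ^ 2 - dist x (γ s) ^ 2) := by
      linarith
    exact le_of_mul_le_mul_left this h0
  have hD := sq_nonneg (dist (γ s) (γ t))
  have h1 := key 1 one_pos le_rfl
  set D := dist (γ s) (γ t) ^ 2
  set A := dist x (γ t) ^ 2 - dist x (γ s) ^ 2 with hA
  have hAD : A < D := by linarith
  have hDpos : 0 < D := by linarith
  -- Any `l` in `(0, 1 - A/D)` contradicts `key`; this is the midpoint of that interval.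
  have h2 := key ((D - A) / (2 * D)) (by apply div_pos <;> linarith)
    (by rw [div_le_one (by linarith)]; linarith)
  have h3 : (1 - (D - A) / (2 * D)) * D = (D + A) / 2 := by field_simp; ring
  rw [h3] at h2
  linarith

/-- Projection to a geodesic is `1`-Lipschitz. -/
theorem abs_sub_le_of_isNearestPoint (hX : IsCAT0 X) (hγ : IsClosedGeodesic γ I) {x y : X}
    {s t : ℝ} (hs : s ∈ I) (hx : IsNearestPoint (γ '' I) x (γ s)) (ht : t ∈ I)
    (hy : IsNearestPoint (γ '' I) y (γ t)) : |s - t| ≤ dist x y := by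
  have h1 := hγ.sq_dist_ge hX hs hx ht
  have h2 := hγ.sq_dist_ge hX ht hy hs
  -- The angles at both feet are at least right angles, so the diagonals of this quadrilateral are
  -- long.
  have h3 := hX.quadrilateral x y (γ s) (γ t)
  rw [dist_comm (γ t) (γ s)] at h2
  rw [dist_comm (γ t) y] at h3
  rw [← hγ.isGeodesic s hs t ht]
  apply le_of_sq_le_sq _ dist_nonneg
  linarith

theorem footParam_eq_iff (hX : IsCAT0 X) (hγ : IsClosedGeodesic γ I) {x : X} {s : ℝ} (hs : s ∈ I) :
    IsNearestPoint (γ '' I) x (γ s) ↔ footParam γ I x = s := by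
  constructor
  · intro h
    have := hγ.abs_sub_le_of_isNearestPoint hX (hγ.footParam_mem x) (hγ.footParam_spec x).2 hs h
    rw [dist_self] at this
    linarith [abs_nonpos_iff.1 this]
  · rintro rfl
    exact (hγ.footParam_spec x).2

theorem abs_footParam_sub_le (hX : IsCAT0 X) (hγ : IsClosedGeodesic γ I) (x y : X) :
    |footParam γ I x - footParam γ I y| ≤ dist x y :=
  hγ.abs_sub_le_of_isNearestPoint hX (hγ.footParam_mem x) (hγ.footParam_spec x).2
    (hγ.footParam_mem y) (hγ.footParam_spec y).2

theorem continuous_footParam (hX : IsCAT0 X) (hγ : IsClosedGeodesic γ I) :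
    Continuous (footParam γ I) := by
  refine LipschitzWith.continuous (K := 1) (LipschitzWith.of_dist_le_mul fun x y => ?_)
  simpa [Real.dist_eq] using hγ.abs_footParam_sub_le hX x y

theorem footParam_apply (hX : IsCAT0 X) (hγ : IsClosedGeodesic γ I) {s : ℝ} (hs : s ∈ I) :
    footParam γ I (γ s) = s :=
  (hγ.footParam_eq_iff hX hs).1 ⟨mem_image_of_mem _ hs, fun q _ => by simp⟩

/-- Points between `x` and its projection have the same projection. -/
theorem footParam_of_between (hX : IsCAT0 X) (hγ : IsClosedGeodesic γ I) {x v : X}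
    (h : dist x v + dist v (γ (footParam γ I x)) = dist x (γ (footParam γ I x))) :
    footParam γ I v = footParam γ I x := by
  refine (hγ.footParam_eq_iff hX (hγ.footParam_mem x)).1
    ⟨mem_image_of_mem _ (hγ.footParam_mem x), ?_⟩
  rintro _ ⟨t, ht, rfl⟩
  have := hγ.dist_footParam_le x ht
  have := dist_triangle x v (γ t)
  linarith

end IsClosedGeodesic

/-! ## Geodesic segments as sets -/

/-- The set of points between `x` and `y`; in a CAT(0) space, the geodesic segment. -/
def seg (x y : X) : Set X := {p | dist x p + dist p y = dist x y}

theorem mem_seg_iff {x y p : X} : p ∈ seg x y ↔ dist x p + dist p y = dist x y := Iff.rfl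

theorem left_mem_seg (x y : X) : x ∈ seg x y := by simp [seg]

theorem right_mem_seg (x y : X) : y ∈ seg x y := by simp [seg]

theorem seg_eq_image (hX : IsCAT0 X) {x y : X} {γ : ℝ → X} (hγ : IsGeodesicFromTo γ x y) :
    seg x y = γ '' Icc 0 (dist x y) := by
  ext p
  constructor
  · intro hp
    obtain ⟨l, hl⟩ := DividesAt.exists_of_dist hp
    have h0 := hl.nonneg
    have h1 := hl.le_one
    have hd := dist_nonneg (x := x) (y := y)
    exact ⟨l * dist x y, ⟨by positivity, mul_le_of_le_one_left hd h1⟩,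
      hX.eq_of_dividesAt_geodesic hγ hl⟩
  · rintro ⟨s, hs, rfl⟩
    rw [mem_seg_iff, hγ.dist_left hs, hγ.dist_right hs]
    ring

theorem isPreconnected_seg (hX : IsCAT0 X) (x y : X) : IsPreconnected (seg x y) := by
  obtain ⟨γ, hγ⟩ := hX.exists_geodesic x y
  rw [seg_eq_image hX hγ]
  exact isPreconnected_Icc.image _ hγ.1.continuousOn

theorem isCompact_seg (hX : IsCAT0 X) (x y : X) : IsCompact (seg x y) := by
  obtain ⟨γ, hγ⟩ := hX.exists_geodesic x y
  rw [seg_eq_image hX hγ]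
  exact isCompact_Icc.image_of_continuousOn hγ.1.continuousOn

theorem seg_comm (x y : X) : seg x y = seg y x := by
  ext p
  rw [mem_seg_iff, mem_seg_iff, dist_comm y p, dist_comm p x, dist_comm y x, add_comm]

theorem seg_subset_left {x y p : X} (hp : p ∈ seg x y) : seg x p ⊆ seg x y := by
  intro q hq
  simp only [mem_seg_iff] at *
  have := dist_triangle x q y
  have := dist_triangle q p y
  linarith

theorem seg_subset_right {x y p : X} (hp : p ∈ seg x y) : seg p y ⊆ seg x y := by
  rw [seg_comm p y, seg_comm x y] at *
  exact seg_subset_left hp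

/-- Concatenating `q ∈ [x, z]` with `z ∈ [x, y]`. -/
theorem mem_seg_right_of_mem_left {x y p q : X} (hp : p ∈ seg x y) (hq : q ∈ seg x p) :
    p ∈ seg q y := by
  simp only [mem_seg_iff] at *
  have := dist_triangle x q y
  have := dist_triangle q p y
  linarith

theorem seg_ordered (hX : IsCAT0 X) {x y p q : X} (hp : p ∈ seg x y) (hq : q ∈ seg x y)
    (h : dist x p ≤ dist x q) : p ∈ seg x q := by
  obtain ⟨γ, hγ⟩ := hX.exists_geodesic x y
  have hpI := hp
  rw [seg_eq_image hX hγ] at hp hq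
  obtain ⟨s, hs, rfl⟩ := hp
  obtain ⟨t, ht, rfl⟩ := hq
  rw [hγ.dist_left hs, hγ.dist_left ht] at h
  rw [mem_seg_iff, hγ.dist_left hs, hγ.dist_left ht, hγ.1 s hs t ht, abs_sub_comm,
    abs_of_nonneg (by linarith)]
  ring

theorem IsClosedGeodesic.footParam_of_mem_seg (hX : IsCAT0 X) {γ : ℝ → X} {I : Set ℝ}
    (hγ : IsClosedGeodesic γ I) {x v : X} (h : v ∈ seg x (γ (footParam γ I x))) :
    footParam γ I v = footParam γ I x := hγ.footParam_of_between hX h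

/-- The preimage of an interval under projection to a geodesic is connected. -/
theorem IsClosedGeodesic.isPreconnected_preimage (hX : IsCAT0 X) {γ : ℝ → X} {I : Set ℝ}
    (hγ : IsClosedGeodesic γ I) {J : Set ℝ} (hJ : J.OrdConnected) :
    IsPreconnected (footParam γ I ⁻¹' J) := by
  refine isPreconnected_of_forall_pair fun x hx y hy => ?_
  set s := footParam γ I x with hs
  set t := footParam γ I y with ht
  have hsI := hγ.footParam_mem x
  have htI := hγ.footParam_mem y
  have hIst : uIcc s t ⊆ I := hγ.ordConnected.uIcc_subset hsI htI
  have hJst : uIcc s t ⊆ J := hJ.uIcc_subset hx hy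
  -- Perpendiculars stay in one fibre of the projection, so this path never leaves the preimage.
  refine ⟨(seg x (γ s) ∪ γ '' uIcc s t) ∪ seg y (γ t), ?_, ?_, ?_, ?_⟩
  · rintro v ((hv | ⟨r, hr, rfl⟩) | hv)
    · rw [mem_preimage, hγ.footParam_of_mem_seg hX hv]; exact hx
    · rw [mem_preimage, hγ.footParam_apply hX (hIst hr)]; exact hJst hr
    · rw [mem_preimage, hγ.footParam_of_mem_seg hX hv]; exact hy
  · exact Or.inl (Or.inl (left_mem_seg _ _))
  · exact Or.inr (left_mem_seg _ _)
  · refine IsPreconnected.union (γ t) (Or.inr (mem_image_of_mem _ right_mem_uIcc))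
      (right_mem_seg _ _) ?_ (isPreconnected_seg hX _ _)
    refine IsPreconnected.union (γ s) (right_mem_seg _ _) (mem_image_of_mem _ left_mem_uIcc)
      (isPreconnected_seg hX _ _) ?_
    exact isPreconnected_uIcc.image _ (hγ.isGeodesic.continuousOn.mono hIst)

/-- The distance from `x` to its projection. -/
noncomputable def height (γ : ℝ → X) (I : Set ℝ) (x : X) : ℝ := dist x (γ (footParam γ I x))

theorem IsClosedGeodesic.height_le {γ : ℝ → X} {I : Set ℝ} (hγ : IsClosedGeodesic γ I) (x y : X) :
    height γ I x ≤ height γ I y + dist x y := by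
  have h1 := hγ.dist_footParam_le x (hγ.footParam_mem y)
  have h2 := dist_triangle x y (γ (footParam γ I y))
  unfold height
  linarith

theorem IsClosedGeodesic.continuous_height {γ : ℝ → X} {I : Set ℝ} (hγ : IsClosedGeodesic γ I) :
    Continuous (height γ I) := by
  refine LipschitzWith.continuous (K := 1) (LipschitzWith.of_dist_le_mul fun x y => ?_)
  have h1 := hγ.height_le x y
  have h2 := hγ.height_le y x
  rw [dist_comm y x] at h2
  rw [Real.dist_eq, NNReal.coe_one, one_mul, abs_le]
  constructor <;> linarith

theorem IsClosedGeodesic.height_of_mem_seg (hX : IsCAT0 X) {γ : ℝ → X} {I : Set ℝ}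
    (hγ : IsClosedGeodesic γ I) {x v : X} (h : v ∈ seg x (γ (footParam γ I x))) :
    dist x v + height γ I v = height γ I x := by
  unfold height
  rw [hγ.footParam_of_mem_seg hX h]
  exact h

theorem IsGeodesicRay.isClosedGeodesic {b : ℝ → X} (hb : IsGeodesicRay b) :
    IsClosedGeodesic b (Ici 0) := ⟨hb, isClosed_Ici, ordConnected_Ici, nonempty_Ici⟩

theorem IsGeodesicFromTo.isClosedGeodesic {γ : ℝ → X} {x y : X} (h : IsGeodesicFromTo γ x y) :
    IsClosedGeodesic γ (Icc 0 (dist x y)) :=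
  ⟨h.1, isClosed_Icc, ordConnected_Icc, nonempty_Icc.2 dist_nonneg⟩

/-! ## Curtains as level sets -/

namespace Curtain

theorem r_mem (h : Curtain X) : h.r ∈ h.I :=
  interior_subset (h.subset_interior ⟨by linarith, by linarith⟩)

theorem Icc_subset (h : Curtain X) : Icc (h.r - 1 / 2) (h.r + 1 / 2) ⊆ h.I :=
  h.subset_interior.trans interior_subset

theorem isClosedGeodesic (h : Curtain X) : IsClosedGeodesic h.γ h.I :=
  ⟨h.isGeodesic, h.isClosed, h.ordConnected, _, h.r_mem⟩

/-- The parameter of the projection to the geodesic dual to the curtain. -/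
noncomputable def foot (h : Curtain X) : X → ℝ := footParam h.γ h.I

variable (hX : IsCAT0 X)
include hX

theorem carrier_eq (h : Curtain X) :
    h.carrier = {x | h.foot x ∈ Icc (h.r - 1 / 2) (h.r + 1 / 2)} := by
  ext x
  constructor
  · rintro ⟨s, hs, hn⟩
    have := (h.isClosedGeodesic.footParam_eq_iff hX (h.Icc_subset hs)).1 hn
    simpa only [mem_ofPred_eq, foot, this] using hs
  · intro hx
    exact ⟨_, hx, (h.isClosedGeodesic.footParam_spec x).2⟩

theorem neg_eq (h : Curtain X) : h.neg = {x | h.foot x < h.r - 1 / 2} := by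
  ext x
  constructor
  · rintro ⟨s, hs, hlt, hn⟩
    have := (h.isClosedGeodesic.footParam_eq_iff hX hs).1 hn
    simpa only [mem_ofPred_eq, foot, this] using hlt
  · intro hx
    exact ⟨_, h.isClosedGeodesic.footParam_mem x, hx, (h.isClosedGeodesic.footParam_spec x).2⟩

theorem pos_eq (h : Curtain X) : h.pos = {x | h.r + 1 / 2 < h.foot x} := by
  ext x
  constructor
  · rintro ⟨s, hs, hlt, hn⟩
    have := (h.isClosedGeodesic.footParam_eq_iff hX hs).1 hn
    simpa only [mem_ofPred_eq, foot, this] using hlt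
  · intro hx
    exact ⟨_, h.isClosedGeodesic.footParam_mem x, hx, (h.isClosedGeodesic.footParam_spec x).2⟩

theorem center_mem (h : Curtain X) : h.γ h.r ∈ h.carrier := by
  rw [h.carrier_eq hX, mem_ofPred_eq, foot, h.isClosedGeodesic.footParam_apply hX h.r_mem]
  constructor <;> linarith

theorem isPreconnected_carrier (h : Curtain X) : IsPreconnected h.carrier := by
  rw [h.carrier_eq hX]
  exact h.isClosedGeodesic.isPreconnected_preimage hX ordConnected_Icc

end Curtain

/-! ## Walls -/

/-- A `1`-Lipschitz function for which preimages of intervals are connected. A curtain is the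
preimage of `[-1/2, 1/2]` under such a function. -/
structure IsWall (ψ : X → ℝ) : Prop where
  abs_sub_le : ∀ x y, |ψ x - ψ y| ≤ dist x y
  isPreconnected : ∀ J : Set ℝ, J.OrdConnected → IsPreconnected (ψ ⁻¹' J)

theorem IsWall.continuous {ψ : X → ℝ} (h : IsWall ψ) : Continuous ψ := by
  refine LipschitzWith.continuous (K := 1) (LipschitzWith.of_dist_le_mul fun x y => ?_)
  simpa [Real.dist_eq] using h.abs_sub_le x y

theorem exists_eq_of_isPreconnected {S : Set X} (hS : IsPreconnected S) {f : X → ℝ}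
    (hf : Continuous f) {x y : X} (hx : x ∈ S) (hy : y ∈ S) {v : ℝ} (h1 : f x ≤ v) (h2 : v ≤ f y) :
    ∃ z ∈ S, f z = v :=
  hS.intermediate_value hx hy hf.continuousOn ⟨h1, h2⟩

theorem Curtain.isWall_foot_sub (hX : IsCAT0 X) (h : Curtain X) :
    IsWall fun x => h.foot x - h.r where
  abs_sub_le x y := by
    simpa [Curtain.foot] using h.isClosedGeodesic.abs_footParam_sub_le hX x y
  isPreconnected J hJ := by
    have : (fun x => h.foot x - h.r) ⁻¹' J = footParam h.γ h.I ⁻¹' ((fun t => t - h.r) ⁻¹' J) := rfl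
    rw [this]
    refine h.isClosedGeodesic.isPreconnected_preimage hX ?_
    exact hJ.preimage_mono fun a b hab => by simpa using hab

theorem IsWall.neg {ψ : X → ℝ} (h : IsWall ψ) : IsWall fun x => -ψ x where
  abs_sub_le x y := by
    have := h.abs_sub_le x y
    rw [abs_sub_comm] at this
    rwa [show -ψ x - -ψ y = ψ y - ψ x by ring]
  isPreconnected J hJ := h.isPreconnected _ (hJ.preimage_anti fun _ _ hab => neg_le_neg hab)

/-- A separating curtain, oriented. -/
theorem Curtain.Separates.exists_wall (hX : IsCAT0 X) {h : Curtain X} {A B : Set X}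
    (hs : h.Separates A B) : ∃ ψ : X → ℝ, IsWall ψ ∧
      (∀ x, x ∈ h.carrier ↔ ψ x ∈ Icc (-1 / 2) (1 / 2)) ∧ (∀ x ∈ A, ψ x < -1 / 2) ∧
      ∀ x ∈ B, 1 / 2 < ψ x := by
  have hc := h.carrier_eq hX
  rw [Curtain.Separates, h.neg_eq hX, h.pos_eq hX] at hs
  rcases hs with ⟨hA, hB⟩ | ⟨hA, hB⟩
  · refine ⟨_, h.isWall_foot_sub hX, fun x => ?_, fun x hx => ?_, fun x hx => ?_⟩
    · rw [hc, mem_ofPred_eq, mem_Icc, mem_Icc]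
      constructor <;> rintro ⟨_, _⟩ <;> constructor <;> linarith
    · have : h.foot x < h.r - 1 / 2 := hA hx
      linarith
    · have : h.r + 1 / 2 < h.foot x := hB hx
      linarith
  · refine ⟨_, (h.isWall_foot_sub hX).neg, fun x => ?_, fun x hx => ?_, fun x hx => ?_⟩
    · rw [hc, mem_ofPred_eq, mem_Icc, mem_Icc]
      constructor <;> rintro ⟨_, _⟩ <;> constructor <;> linarith
    · have : h.r + 1 / 2 < h.foot x := hA hx
      linarith
    · have : h.foot x < h.r - 1 / 2 := hB hx
      linarith

/-- The interior curtains of a chain are given by nested oriented walls. -/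
theorem Curtain.IsChainOfLength.exists_walls (hX : IsCAT0 X) {N : ℕ∞} {k : ℕ → Curtain X}
    (hk : Curtain.IsChainOfLength N k) : ∃ χ : ℕ → X → ℝ,
      (∀ i : ℕ, ((i + 2 : ℕ) : ℕ∞) < N → IsWall (χ i) ∧
        ∀ x, x ∈ (k (i + 1)).carrier ↔ χ i x ∈ Icc (-1 / 2) (1 / 2)) ∧
      ∀ i : ℕ, ((i + 3 : ℕ) : ℕ∞) < N → ∀ x, χ i x ≤ 1 / 2 → χ (i + 1) x < -1 / 2 := by
  have hex : ∀ i : ℕ, ∃ ψ : X → ℝ, ((i + 2 : ℕ) : ℕ∞) < N → IsWall ψ ∧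
      (∀ x, x ∈ (k (i + 1)).carrier ↔ ψ x ∈ Icc (-1 / 2) (1 / 2)) ∧
      (∀ x ∈ (k i).carrier, ψ x < -1 / 2) ∧ ∀ x ∈ (k (i + 2)).carrier, 1 / 2 < ψ x := by
    intro i
    by_cases hi : ((i + 2 : ℕ) : ℕ∞) < N
    · obtain ⟨ψ, h⟩ := (hk.2 i hi).exists_wall hX
      exact ⟨ψ, fun _ => h⟩
    · exact ⟨fun _ => 0, fun h => absurd h hi⟩
  choose χ hχ using hex
  refine ⟨χ, fun i hi => ⟨(hχ i hi).1, (hχ i hi).2.1⟩, fun i hi x hx => ?_⟩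
  have hi' : ((i + 2 : ℕ) : ℕ∞) < N := lt_of_le_of_lt (by exact_mod_cast (by omega)) hi
  obtain ⟨w1, c1, n1, p1⟩ := hχ i hi'
  obtain ⟨w2, c2, n2, p2⟩ := hχ (i + 1) hi
  by_contra hcon
  push Not at hcon
  have hp : (k (i + 1)).γ (k (i + 1)).r ∈ (k (i + 1)).carrier := (k (i + 1)).center_mem hX
  have hpre := w1.isPreconnected (Iic (1 / 2)) ordConnected_Iic
  -- The near side of wall `i` together with its curtain is connected. If it reached wall `i + 1` it
  -- would contain a point of the next curtain, which lies on the far side of wall `i`.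
  obtain ⟨z, hz, hz0⟩ := exists_eq_of_isPreconnected hpre w2.continuous
    (x := (k (i + 1)).γ (k (i + 1)).r) (y := x) ((c1 _).1 hp).2 hx (v := -1 / 2)
    (n2 _ hp).le hcon
  have hzc : z ∈ (k (i + 2)).carrier := (c2 z).2 (by rw [hz0]; constructor <;> norm_num)
  have := p1 z hzc
  exact absurd (show χ i z ≤ 1 / 2 from hz) (by linarith)

theorem nested_walls {α : Type*} {χ : ℕ → α → ℝ} {n : ℕ}
    (hn : ∀ i < n, ∀ x, χ i x ≤ 1 / 2 → χ (i + 1) x < -1 / 2) {i j : ℕ} (hij : i < j) (hj : j ≤ n)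
    {x : α} (hx : χ i x ≤ 1 / 2) : χ j x < -1 / 2 := by
  induction j, hij using Nat.le_induction with
  | base => exact hn i (by omega) x hx
  | succ j hij ih =>
    exact hn j (by omega) x ((ih (by omega)).le.trans (by norm_num))

/-- Crossing walls takes distance. -/
theorem le_dist_of_walls (hX : IsCAT0 X) {χ : ℕ → X → ℝ} {i j : ℕ}
    (hw : ∀ m ≤ i + j + 1, IsWall (χ m))
    (hn : ∀ m < i + j + 1, ∀ x, χ m x ≤ 1 / 2 → χ (m + 1) x < -1 / 2) {x y : X}
    (hx : χ i x ≤ 1 / 2) (hy : -1 / 2 ≤ χ (i + j + 1) y) : (j : ℝ) ≤ dist x y := by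
  induction j generalizing y with
  | zero => simp
  | succ j ih =>
    have h1 : 1 / 2 < χ (i + j + 1) y := by
      by_contra! hcon
      have := hn (i + j + 1) (by omega) y hcon
      have e : i + (j + 1) + 1 = i + j + 1 + 1 := by omega
      rw [e] at hy
      linarith
    have h2 := nested_walls (n := i + j + 1) (fun m hm => hn m (by omega))
      (show i < i + j + 1 by omega) le_rfl hx
    -- The segment enters the curtain of wall `i + j + 1` at `z`; traversing it from there to `y`
    -- costs at least `1`.
    obtain ⟨z, hz, hz0⟩ := exists_eq_of_isPreconnected (isPreconnected_seg hX x y)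
      (hw (i + j + 1) (by omega)).continuous (left_mem_seg x y) (right_mem_seg x y)
      (v := -1 / 2) h2.le (by linarith)
    have h3 := ih (fun m hm => hw m (by omega)) (fun m hm => hn m (by omega)) (y := z) hz0.ge
    have h4 := (abs_le.1 ((hw (i + j + 1) (by omega)).abs_sub_le y z)).2
    rw [dist_comm] at h4
    rw [mem_seg_iff] at hz
    push_cast
    linarith

/-! ## Curtains dual to a geodesic -/

/-- Curtains dual to a common geodesic, with disjoint poles in increasing order, form a chain. -/
theorem Curtain.isChainOfLength_of_dual (hX : IsCAT0 X) {γ : ℝ → X} {I : Set ℝ} {N : ℕ∞}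
    {k : ℕ → Curtain X} (hfoot : ∀ i, (k i).foot = footParam γ I)
    (hr : ∀ i j : ℕ, (j : ℕ∞) < N → i < j → (k i).r + 1 < (k j).r) :
    Curtain.IsChainOfLength N k := by
  refine ⟨fun i j hi hj hij => ?_, fun i hi => Or.inl ⟨?_, ?_⟩⟩
  · rw [(k i).carrier_eq hX, (k j).carrier_eq hX, hfoot, hfoot, Set.disjoint_left]
    rintro x ⟨h1, h2⟩ ⟨h3, h4⟩
    rcases Nat.lt_or_gt_of_ne hij with h | h
    · have := hr i j hj h; linarith
    · have := hr j i hi h; linarith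
  · rw [(k i).carrier_eq hX, (k (i + 1)).neg_eq hX, hfoot, hfoot]
    rintro x ⟨h1, h2⟩
    have := hr i (i + 1) (lt_of_le_of_lt (by exact_mod_cast (by omega)) hi) (by omega)
    simp only [mem_ofPred_eq]
    linarith
  · rw [(k (i + 2)).carrier_eq hX, (k (i + 1)).pos_eq hX, hfoot, hfoot]
    rintro x ⟨h1, h2⟩
    have := hr (i + 1) (i + 2) hi (by omega)
    simp only [mem_ofPred_eq]
    linarith

theorem Curtain.LSeparated.nonneg {L : ℝ} {h h' : Curtain X} (hs : Curtain.LSeparated L h h') :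
    0 ≤ L := by
  obtain ⟨n, -, hn⟩ := hs.2 0 (fun _ => h) ⟨by simp, by simp⟩ (by simp)
  exact le_trans (Nat.cast_nonneg n) hn

/-- The projections of `L`-separated curtains to a geodesic have bounded overlap. -/
theorem Curtain.LSeparated.overlap_le (hX : IsCAT0 X) {L : ℝ} {h h' : Curtain X}
    (hs : Curtain.LSeparated L h h') {γ : ℝ → X} {I : Set ℝ} (hγ : IsClosedGeodesic γ I)
    {a c a' c' : X} (ha : a ∈ h.carrier) (hc : c ∈ h.carrier) (ha' : a' ∈ h'.carrier)
    (hc' : c' ∈ h'.carrier) {u v : ℝ} (hau : footParam γ I a ≤ u) (hcv : v ≤ footParam γ I c)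
    (hau' : footParam γ I a' ≤ u) (hcv' : v ≤ footParam γ I c') : v - u ≤ 2 * L + 4 := by
  by_contra! hcon
  have hL := hs.nonneg
  set n := ⌊L⌋₊ + 1 with hn
  have hnL : (n : ℝ) ≤ L + 1 := by
    rw [hn]; push_cast; linarith [Nat.floor_le hL]
  have hnL' : L < n := by rw [hn]; exact_mod_cast Nat.lt_floor_add_one L
  have huv : Ioo u v ⊆ interior I := by
    rw [isOpen_Ioo.subset_interior_iff]
    intro s hs
    exact hγ.ordConnected.out (hγ.footParam_mem a) (hγ.footParam_mem c)
      ⟨by linarith [hs.1], by linarith [hs.2]⟩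
  -- More than `L` curtains dual to `γ` fit over `(u, v)`, and connectedness makes `h` and `h'` meet
  -- them all. Truncating the index makes every term of the sequence a legitimate curtain, including
  -- those beyond the chain.
  set r : ℕ → ℝ := fun i => u + 1 + 2 * ((min i (n - 1) : ℕ) : ℝ) with hr
  have hru : ∀ i, u + 1 ≤ r i := fun i => by
    have : (0 : ℝ) ≤ ((min i (n - 1) : ℕ) : ℝ) := Nat.cast_nonneg _
    simp only [hr]; linarith
  have hrv : ∀ i, r i + 1 < v := fun i => by
    have h1 : (min i (n - 1) : ℕ) + 1 ≤ n := by omega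
    have h2 : ((min i (n - 1) : ℕ) : ℝ) + 1 ≤ n := by exact_mod_cast h1
    simp only [hr]; linarith
  let k : ℕ → Curtain X := fun i =>
    { γ := γ
      I := I
      r := r i
      isClosed := hγ.isClosed
      ordConnected := hγ.ordConnected
      isGeodesic := hγ.isGeodesic
      subset_interior := fun s hs => huv
        ⟨by linarith [hs.1, hru i], by linarith [hs.2, hrv i]⟩ }
  have hchain : Curtain.IsChainOfLength n k := by
    refine Curtain.isChainOfLength_of_dual hX (γ := γ) (I := I) (fun i => rfl) fun i j hj hij => ?_
    have hj' : j < n := by exact_mod_cast hj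
    have e1 : min i (n - 1) = i := by omega
    have e2 : min j (n - 1) = j := by omega
    have : (i : ℝ) + 1 ≤ j := by exact_mod_cast hij
    show r i + 1 < r j
    simp only [hr, e1, e2]
    linarith
  have hmeet : ∀ (g : Curtain X) (p q : X), p ∈ g.carrier → q ∈ g.carrier →
      footParam γ I p ≤ u → v ≤ footParam γ I q → ∀ i, ((k i).carrier ∩ g.carrier).Nonempty := by
    intro g p q hp hq hpu hqv i
    obtain ⟨z, hz, hz0⟩ := exists_eq_of_isPreconnected (g.isPreconnected_carrier hX)
      (hγ.continuous_footParam hX) hp hq (v := r i) (by linarith [hru i]) (by linarith [hrv i])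
    refine ⟨z, ?_, hz⟩
    rw [(k i).carrier_eq hX]
    show footParam γ I z ∈ Icc (r i - 1 / 2) (r i + 1 / 2)
    rw [hz0]
    constructor <;> linarith
  obtain ⟨n', hn', hle⟩ := hs.2 n k hchain fun i _ =>
    ⟨hmeet h a c ha hc hau hcv i, hmeet h' a' c' ha' hc' hau' hcv' i⟩
  have : n = n' := by exact_mod_cast hn'
  rw [← this] at hle
  linarith

/-- The number of curtains of a chain meeting a set of bounded diameter is bounded. -/
theorem Curtain.IsChainOfLength.exists_length_le (hX : IsCAT0 X) {N : ℕ∞} {k : ℕ → Curtain X}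
    (hk : Curtain.IsChainOfLength N k) {D : ℝ} {w : ℕ → X}
    (hw : ∀ i : ℕ, (i : ℕ∞) < N → w i ∈ (k i).carrier)
    (hD : ∀ i j : ℕ, (i : ℕ∞) < N → (j : ℕ∞) < N → dist (w i) (w j) ≤ D) (hD0 : 0 ≤ D) :
    ∃ n : ℕ, N = n ∧ (n : ℝ) ≤ D + 4 := by
  obtain ⟨χ, h1, h2⟩ := hk.exists_walls hX
  have key : ∀ m : ℕ, (m : ℕ∞) < N → (m : ℝ) ≤ D + 3 := by
    intro m hm
    rcases Nat.lt_or_ge m 3 with h | h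
    · have : (m : ℝ) ≤ 3 := by exact_mod_cast h.le
      linarith
    · obtain ⟨j, rfl⟩ := Nat.exists_eq_add_of_le' h
      have lt : ∀ i : ℕ, i ≤ j + 3 → (i : ℕ∞) < N := fun i hi =>
        lt_of_le_of_lt (by exact_mod_cast hi) hm
      have a1 := (h1 0 (lt _ (by omega))).2 (w 1) |>.1 (hw 1 (lt _ (by omega)))
      have a2 := (h1 (j + 1) (lt _ (by omega))).2 (w (j + 2)) |>.1 (hw (j + 2) (lt _ (by omega)))
      -- The end curtains have no wall, and only walls strictly between the two points are counted;
      -- these losses give the additive constant.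
      have := le_dist_of_walls hX (χ := χ) (i := 0) (j := j)
        (fun m hm => (h1 m (lt _ (by omega))).1) (fun m hm => h2 m (lt _ (by omega)))
        (x := w 1) (y := w (j + 2)) a1.2 (by rw [Nat.zero_add]; exact a2.1)
      have := hD 1 (j + 2) (lt _ (by omega)) (lt _ (by omega))
      push_cast
      linarith
  induction N using ENat.recTopCoe with
  | top =>
    obtain ⟨m, hm⟩ := exists_nat_gt (D + 3)
    exact absurd (key m (ENat.natCast_lt_top m)) (not_le.2 hm)
  | coe n =>
    refine ⟨n, rfl, ?_⟩
    rcases n with _ | n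
    · simp; linarith
    · have := key n (by exact_mod_cast Nat.lt_succ_self n)
      push_cast
      linarith

/-! ## Sublinear functions -/

namespace IsSublinear

variable {κ : ℝ → ℝ} (hκ : IsSublinear κ)
include hκ

/-- Concavity and `κ 0 ≥ 0` make `κ(s)/s` nonincreasing, whence subadditivity. -/
theorem add_le {s t : ℝ} (hs : 0 ≤ s) (ht : 0 ≤ t) : κ (s + t) ≤ κ s + κ t := by
  have key : ∀ {a b : ℝ}, 0 ≤ a → 0 ≤ b → 0 < a + b → a / (a + b) * κ (a + b) ≤ κ a := by
    intro a b ha hb hab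
    have h := hκ.concave.2 (show a + b ∈ Ici 0 from hab.le) (show (0 : ℝ) ∈ Ici 0 from self_mem_Ici)
      (show 0 ≤ a / (a + b) by positivity) (show 0 ≤ b / (a + b) by positivity) (by field_simp)
    simp only [smul_eq_mul, mul_zero, add_zero] at h
    rw [div_mul_cancel₀ _ hab.ne'] at h
    have : 0 ≤ b / (a + b) * κ 0 := by
      have := hκ.one_le 0 le_rfl
      positivity
    linarith
  rcases (add_nonneg hs ht).eq_or_lt with h0 | h0
  · have h1 : s = 0 := by linarith
    have h2 : t = 0 := by linarith
    have := hκ.one_le 0 le_rfl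
    subst h1 h2
    simp; linarith
  · have h1 := key hs ht h0
    have h2 := key ht hs (by linarith)
    rw [add_comm t s] at h2
    have h3 : s / (s + t) * κ (s + t) + t / (s + t) * κ (s + t) = κ (s + t) := by
      rw [← add_mul, ← add_div, div_self h0.ne', one_mul]
    linarith

theorem exists_le_mul_add {η : ℝ} (hη : 0 < η) : ∃ c, 0 ≤ c ∧ ∀ s, 0 ≤ s → κ s ≤ η * s + c := by
  have h := (hκ.tendsto.eventually (gt_mem_nhds hη)).and (eventually_gt_atTop (0 : ℝ))
  obtain ⟨A, hA⟩ := eventually_atTop.1 h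
  set B := max A 1
  have hB : 0 ≤ B := le_trans zero_le_one (le_max_right _ _)
  have hκB := hκ.one_le B hB
  refine ⟨κ B, by linarith, fun s hs => ?_⟩
  rcases le_total B s with h | h
  · obtain ⟨h1, h2⟩ := hA s ((le_max_left _ _).trans h)
    rw [div_lt_iff₀ h2] at h1
    linarith
  · have := hκ.monotone hs hB h
    have := mul_nonneg hη.le hs
    linarith

/-- This breaks a circularity: the scale `M κ(t)` must dominate `D κ` at points whose distance from
the base point itself depends on `M`. By sublinearity the increment `n M κ(t)` contributes at most
half of `M κ(t)`, whatever `M` is. -/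
theorem exists_scale {D t₀ : ℝ} (hD : 0 ≤ D) (ht₀ : 0 ≤ t₀) {n : ℝ} (hn : 0 < n) :
    ∃ M, 1 ≤ M ∧ ∀ t, 0 ≤ t → D * κ (t + t₀ + n * M * κ t) ≤ M * κ t := by
  obtain ⟨c, hc, h⟩ := hκ.exists_le_mul_add (η := 1 / (2 * n * (D + 1))) (by positivity)
  have hκ0 := hκ.one_le t₀ ht₀
  refine ⟨2 * (D * (1 + κ t₀ + c)) + 1, ?_, fun t ht => ?_⟩
  · have : 0 ≤ D * (1 + κ t₀ + c) := mul_nonneg hD (by linarith)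
    linarith
  set M := 2 * (D * (1 + κ t₀ + c)) + 1 with hM
  have hM0 : 0 ≤ M := by
    have : 0 ≤ D * (1 + κ t₀ + c) := mul_nonneg hD (by linarith)
    linarith
  have hκt := hκ.one_le t ht
  have hnM : 0 ≤ n * M * κ t := by positivity
  have h1 := hκ.add_le (add_nonneg ht ht₀) hnM
  have h2 := hκ.add_le ht ht₀
  have h3 := h _ hnM
  have h4 : D * (1 / (2 * n * (D + 1)) * (n * M * κ t)) ≤ M * κ t / 2 := by
    have : D * (1 / (2 * n * (D + 1)) * (n * M * κ t)) = D / (D + 1) * (M * κ t / 2) := by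
      field_simp
    rw [this]
    apply mul_le_of_le_one_left (by positivity)
    rw [div_le_one (by linarith)]; linarith
  have h5 : D * κ (t + t₀ + n * M * κ t) ≤
      D * (κ t + κ t₀ + (1 / (2 * n * (D + 1)) * (n * M * κ t) + c)) :=
    mul_le_mul_of_nonneg_left (by linarith) hD
  have h6 : D * (κ t + κ t₀ + c) ≤ D * (1 + κ t₀ + c) * κ t := by
    have : κ t + κ t₀ + c ≤ (1 + κ t₀ + c) * κ t := by nlinarith
    calc _ ≤ D * ((1 + κ t₀ + c) * κ t) := mul_le_mul_of_nonneg_left this hD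
      _ = _ := by ring
  have h7 : M * κ t / 2 = D * (1 + κ t₀ + c) * κ t + κ t / 2 := by rw [hM]; ring
  nlinarith

/-- The gap condition bounds `s'` in terms of `κ s'`. Sublinearity absorbs half of `s'`, leaving `s'
≤ 2s + const`, to which subadditivity applies. -/
theorem exists_le_mul_of_gap {C : ℝ} (hC : 0 < C) : ∃ D, 1 ≤ D ∧ ∀ s s', 0 ≤ s → 0 ≤ s' →
    s' ≤ s + C * κ s' → κ s' ≤ D * κ s := by
  obtain ⟨c, hc, h⟩ := hκ.exists_le_mul_add (η := 1 / (2 * C)) (by positivity)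
  have hκc := hκ.one_le (2 * (C * c)) (by positivity)
  refine ⟨2 + κ (2 * (C * c)), by linarith, fun s s' hs hs' hgap => ?_⟩
  have h1 := mul_le_mul_of_nonneg_left (h s' hs') hC.le
  have h2 : C * (1 / (2 * C) * s' + c) = s' / 2 + C * c := by field_simp
  have h3 : s' ≤ s + s + 2 * (C * c) := by linarith
  have h4 := hκ.monotone hs' (show 0 ≤ s + s + 2 * (C * c) by positivity) h3
  have h5 := hκ.add_le (add_nonneg hs hs) (show 0 ≤ 2 * (C * c) by positivity)
  have h6 := hκ.add_le hs hs
  have h7 := hκ.one_le s hs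
  nlinarith

end IsSublinear

/-! ## Segments over a geodesic along which projection is contracting -/

theorem exists_mem_seg_dist_eq (hX : IsCAT0 X) {x y : X} {p : ℝ} (h0 : 0 ≤ p)
    (h1 : p ≤ dist x y) : ∃ u ∈ seg x y, dist x u = p := by
  obtain ⟨γ, hγ⟩ := hX.exists_geodesic x y
  refine ⟨γ p, ?_, hγ.dist_left ⟨h0, h1⟩⟩
  rw [seg_eq_image hX hγ]
  exact mem_image_of_mem _ ⟨h0, h1⟩

theorem le_dist_of_mem_seg (hX : IsCAT0 X) {x z m w : X} {ρ : ℝ} (hw : w ∈ seg z m)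
    (hpos : 0 < dist z w) (h : dist x z + ρ * dist z w ≤ dist x w) :
    dist x z + ρ * dist z m ≤ dist x m := by
  obtain ⟨l, hl⟩ := DividesAt.exists_of_dist hw
  refine hX.le_dist_of_dividesAt hl (hl.nonneg.lt_of_ne ?_) h
  rintro rfl
  rw [hl.dist_left, zero_mul] at hpos
  exact lt_irrefl _ hpos

theorem dist_le_of_mem_seg_hinge (hX : IsCAT0 X) {m y z p q : X} {c : ℝ} (hp : p ∈ seg m y)
    (hq : q ∈ seg m z) (hpq : dist m p = dist m q) (hc : 0 ≤ c)
    (h : (dist y z + dist m y - dist m z) * (dist y z + dist m z - dist m y) ≤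
      c ^ 2 * (dist m y * dist m z)) : dist p q ≤ c * dist m p := by
  obtain ⟨l, hl⟩ := DividesAt.exists_of_dist hp
  obtain ⟨k, hk⟩ := DividesAt.exists_of_dist hq
  exact hX.dist_le_of_hinge hl hk hpq hc h

theorem IsClosedGeodesic.dist_le_heights {γ : ℝ → X} {I : Set ℝ} (hγ : IsClosedGeodesic γ I)
    (x y : X) : dist x y ≤
      height γ I x + |footParam γ I x - footParam γ I y| + height γ I y := by
  have h := dist_triangle4 x (γ (footParam γ I x)) (γ (footParam γ I y)) y
  rw [hγ.isGeodesic _ (hγ.footParam_mem x) _ (hγ.footParam_mem y),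
    dist_comm (γ (footParam γ I y)) y] at h
  exact h

section Contraction

variable {γ : ℝ → X} {I : Set ℝ}

/-- If balls of radius about `H / 600` centred on `[m, z]` have small projection, and the
projections of `m` and `z` are far apart, then `[m, z]` comes close to `γ`, and quickly so. -/
theorem IsClosedGeodesic.exists_dip (hX : IsCAT0 X) (hγ : IsClosedGeodesic γ I) {m z : X} {H : ℝ}
    (hH : 0 < H) (hm : height γ I m = H) (hz : height γ I z = H)
    (h1 : H ≤ |footParam γ I m - footParam γ I z|)
    (h2 : |footParam γ I m - footParam γ I z| ≤ 2 * H)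
    (hcon : ∀ p ∈ seg m z, ∀ q, dist p q < height γ I p →
      |footParam γ I p - footParam γ I q| ≤ H / (600 * 2401)) :
    ∃ w ∈ seg m z, height γ I w ≤ H / 600 ∧ dist m w ≤ (1 + 1 / 300) * H := by
  obtain ⟨c, hc⟩ := hX.exists_geodesic m z
  have hseg := seg_eq_image hX hc
  have hL : dist m z ≤ 4 * H := by
    have := hγ.dist_le_heights m z
    linarith
  have step : ∀ s₁ ∈ Icc 0 (dist m z), (∀ s, 0 ≤ s → s < s₁ → H / 600 < height γ I (c s)) →
      |footParam γ I m - footParam γ I (c s₁)| ≤ H / 600 := by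
    intro s₁ hs₁ hlow
    rcases hs₁.1.eq_or_lt with h0 | h0
    · rw [← h0, hc.2.1]; simp; positivity
    -- As the length is at most `4H`, `2401 > 4 * 600` pieces are each shorter than `H / 600`, hence
    -- shorter than the height of their starting points. The projection moves by at most `H / (600 *
    -- 2401)` on each piece.
    have ind : ∀ i : ℕ, i ≤ 2401 →
        |footParam γ I m - footParam γ I (c (s₁ * (i / 2401)))| ≤ i * (H / (600 * 2401)) := by
      intro i
      induction i with
      | zero => intro _; simp [hc.2.1]
      | succ i ih =>
        intro hi
        have ih := ih (by omega)
        have hi' : (i : ℝ) + 1 ≤ 2401 := by exact_mod_cast hi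
        have hi0 : (0 : ℝ) ≤ i := Nat.cast_nonneg i
        have ha : s₁ * (i / 2401) < s₁ := by
          apply mul_lt_of_lt_one_right h0
          rw [div_lt_one (by norm_num)]; linarith
        have ha0 : 0 ≤ s₁ * (i / 2401) := by positivity
        have hb : s₁ * (((i + 1 : ℕ) : ℝ) / 2401) = s₁ * (i / 2401) + s₁ / 2401 := by
          push_cast; ring
        have hb1 : s₁ * (((i + 1 : ℕ) : ℝ) / 2401) ≤ s₁ := by
          apply mul_le_of_le_one_right h0.le
          rw [div_le_one (by norm_num)]; push_cast; linarith
        have hm1 : s₁ * (i / 2401) ∈ Icc 0 (dist m z) := ⟨ha0, ha.le.trans hs₁.2⟩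
        have hm2 : s₁ * (((i + 1 : ℕ) : ℝ) / 2401) ∈ Icc 0 (dist m z) :=
          ⟨by positivity, hb1.trans hs₁.2⟩
        have hd : dist (c (s₁ * (i / 2401))) (c (s₁ * (((i + 1 : ℕ) : ℝ) / 2401))) = s₁ / 2401 := by
          rw [hc.1 _ hm1 _ hm2, hb, sub_add_cancel_left, abs_neg, abs_of_nonneg (by positivity)]
        have hlow' := hlow _ ha0 ha
        have := hcon (c (s₁ * (i / 2401))) (hseg ▸ mem_image_of_mem c hm1)
          (c (s₁ * (((i + 1 : ℕ) : ℝ) / 2401))) (by rw [hd]; linarith [hs₁.2])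
        have t := abs_sub_le (footParam γ I m) (footParam γ I (c (s₁ * (i / 2401))))
          (footParam γ I (c (s₁ * (((i + 1 : ℕ) : ℝ) / 2401))))
        have e : ((i + 1 : ℕ) : ℝ) * (H / (600 * 2401)) =
          i * (H / (600 * 2401)) + H / (600 * 2401) := by push_cast; ring
        linarith
    have := ind 2401 le_rfl
    norm_num at this
    linarith
  set S := Icc 0 (dist m z) ∩ (fun s => height γ I (c s)) ⁻¹' Iic (H / 600) with hS
  have hScl : IsClosed S :=
    (hγ.continuous_height.comp_continuousOn hc.1.continuousOn).preimage_isClosed_of_isClosed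
      isClosed_Icc isClosed_Iic
  have hSc : IsCompact S := isCompact_Icc.of_isClosed_subset hScl inter_subset_left
  have hSne : S.Nonempty := by
    by_contra hne
    rw [not_nonempty_iff_eq_empty] at hne
    have := step (dist m z) ⟨dist_nonneg, le_rfl⟩ fun s h0 hs => by
      by_contra! hcon'
      have : s ∈ S := ⟨⟨h0, hs.le⟩, hcon'⟩
      rw [hne] at this
      exact this
    rw [hc.2.2] at this
    linarith
  -- At the first dip the projection has moved at most `H / 600`, so the distance from `m` is at
  -- most `H + 2 * H / 600`.
  obtain ⟨s₁, hs₁, hleast⟩ := hSc.exists_isLeast hSne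
  have hst := step s₁ hs₁.1 fun s h0 hs => by
    by_contra! hcon'
    have := hleast ⟨⟨h0, hs.le.trans hs₁.1.2⟩, hcon'⟩
    linarith
  have hlow : height γ I (c s₁) ≤ H / 600 := hs₁.2
  refine ⟨c s₁, hseg ▸ mem_image_of_mem c hs₁.1, hlow, ?_⟩
  have := hγ.dist_le_heights m (c s₁)
  linarith

/-- If `[m₀, z₀]` dips towards `γ` near both ends, where `m₀` and `z₀` lie on the perpendiculars
from `m` and `x` to `γ`, then so does `[m, x]` near `m`. -/
theorem IsClosedGeodesic.exists_height_lt_of_dip (hX : IsCAT0 X) (hγ : IsClosedGeodesic γ I)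
    {m x m₀ z₀ w w' : X} {H : ℝ} (hH : 0 < H) (hm₀ : m₀ ∈ seg m (γ (footParam γ I m)))
    (hm₀H : height γ I m₀ = H) (hz₀ : z₀ ∈ seg x (γ (footParam γ I x)))
    (hz₀H : height γ I z₀ = H) (hL : dist m₀ z₀ ≤ height γ I m - H)
    (hw : w ∈ seg m₀ z₀) (hwH : height γ I w ≤ H / 600) (hwd : dist m₀ w ≤ (1 + 1 / 300) * H)
    (hw' : w' ∈ seg m₀ z₀) (hwH' : height γ I w' ≤ H / 600)
    (hwd' : dist z₀ w' ≤ (1 + 1 / 300) * H) :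
    ∃ u ∈ seg m x, height γ I u < height γ I m := by
  have ha₁ := hγ.height_of_mem_seg hX hm₀
  have ha₂ := hγ.height_of_mem_seg hX hz₀
  rw [hm₀H] at ha₁
  rw [hz₀H] at ha₂
  -- the distance to `m` grows fast along `[m₀, z₀]`
  have hmw := hγ.height_le m w
  have hm₀w := hγ.height_le m₀ w
  -- Descending to `w` gains at least `(1 - 1/600) H` in distance from `m` over a length of at most
  -- `(1 + 1/300) H`; convexity propagates this rate.
  have g1 : dist m m₀ + 199 / 200 * dist m₀ z₀ ≤ dist m z₀ :=
    le_dist_of_mem_seg hX hw (by linarith) (by linarith)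
  have hLpos : 0 < dist m₀ z₀ := by
    have := dist_nonneg (x := w) (y := z₀)
    rw [mem_seg_iff] at hw
    linarith
  have t1 := dist_triangle m m₀ z₀
  have t2 := dist_triangle m z₀ m₀
  have t3 := dist_triangle m₀ m z₀
  rw [dist_comm z₀ m₀] at t2
  rw [dist_comm m₀ m] at t3
  -- `[z₀, m]` leaves `z₀` in nearly the same direction as `[z₀, m₀]`
  have hw'₂ : w' ∈ seg z₀ m₀ := seg_comm m₀ z₀ ▸ hw'
  have hz₀w' := hγ.height_le z₀ w'
  have he'L : dist z₀ w' ≤ dist m₀ z₀ := by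
    have := dist_nonneg (x := w') (y := m₀)
    rw [mem_seg_iff, dist_comm z₀ m₀] at hw'₂
    linarith
  obtain ⟨u₁, hu₁, hu₁d⟩ := exists_mem_seg_dist_eq hX (x := z₀) (y := m) (p := dist z₀ w')
    dist_nonneg (by rw [dist_comm z₀ m]; linarith)
  have g2 : dist w' u₁ ≤ 1 / 10 * dist z₀ w' := by
    refine dist_le_of_mem_seg_hinge hX hw'₂ hu₁ hu₁d.symm (by norm_num) ?_
    rw [dist_comm m₀ m, dist_comm z₀ m₀, dist_comm z₀ m]
    calc (dist m m₀ + dist m₀ z₀ - dist m z₀) * (dist m m₀ + dist m z₀ - dist m₀ z₀)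
        ≤ (dist m₀ z₀ / 200) * (2 * dist m z₀) := by
          apply mul_le_mul <;> linarith
      _ = _ := by ring
  have g3 : dist x z₀ + 7 / 8 * dist z₀ m ≤ dist x m := by
    refine le_dist_of_mem_seg hX hu₁ (by linarith) ?_
    have h1 := hγ.height_le u₁ w'
    have h2 := hγ.height_le x u₁
    rw [dist_comm u₁ w'] at h1
    rw [hu₁d]
    linarith
  rw [dist_comm x z₀, dist_comm z₀ m, dist_comm x m] at g3
  have t4 := dist_triangle m z₀ x
  have t5 := dist_triangle z₀ m x
  have t6 := dist_triangle m x z₀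
  rw [dist_comm z₀ m] at t5
  rw [dist_comm x z₀] at t6
  -- the three segments from `m` to `m₀`, `z₀` and `x` have nearly the same direction
  have hp0 : 0 ≤ dist m m₀ / 2 := by positivity
  have hzx := dist_nonneg (x := z₀) (y := x)
  obtain ⟨m₁, hm₁, hm₁d⟩ := exists_mem_seg_dist_eq hX (x := m) (y := m₀) hp0 (by linarith)
  obtain ⟨u₂, hu₂, hu₂d⟩ := exists_mem_seg_dist_eq hX (x := m) (y := z₀) hp0 (by linarith)
  obtain ⟨u₃, hu₃, hu₃d⟩ := exists_mem_seg_dist_eq hX (x := m) (y := x) hp0 (by linarith)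
  have g4 : dist m₁ u₂ ≤ 1 / 10 * dist m m₁ := by
    refine dist_le_of_mem_seg_hinge hX hm₁ hu₂ (by rw [hm₁d, hu₂d]) (by norm_num) ?_
    calc (dist m₀ z₀ + dist m m₀ - dist m z₀) * (dist m₀ z₀ + dist m z₀ - dist m m₀)
        ≤ (dist m₀ z₀ / 200) * (2 * dist m₀ z₀) := by
          apply mul_le_mul <;> linarith
      _ = (1 / 10) ^ 2 * (dist m₀ z₀ * dist m₀ z₀) := by ring
      _ ≤ _ := by
          apply mul_le_mul_of_nonneg_left _ (by norm_num)
          apply mul_le_mul <;> linarith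
  have g5 : dist u₂ u₃ ≤ 1 / 2 * dist m u₂ := by
    refine dist_le_of_mem_seg_hinge hX hu₂ hu₃ (by rw [hu₂d, hu₃d]) (by norm_num) ?_
    calc (dist z₀ x + dist m z₀ - dist m x) * (dist z₀ x + dist m x - dist m z₀)
        ≤ (dist m z₀ / 8) * (2 * dist m x) := by
          apply mul_le_mul <;> linarith
      _ = _ := by ring
  -- The point `m₁` is lower than `m` by `d(m, m₁)`, and `u₃` is within `(1/10 + 1/2) d(m, m₁)` of
  -- it.
  refine ⟨u₃, hu₃, ?_⟩
  have h1 := hγ.height_of_mem_seg hX (seg_subset_left hm₀ hm₁)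
  have h2 := hγ.height_le u₃ m₁
  have h3 := dist_triangle_right u₃ m₁ u₂
  rw [dist_comm u₃ u₂] at h3
  linarith

/-- A segment projecting onto an interval of length `2 * H` over which projection is contracting
at scale `H` comes within `5 * H` of the geodesic. -/
theorem IsClosedGeodesic.exists_height_lt (hX : IsCAT0 X) (hγ : IsClosedGeodesic γ I) {x y : X}
    {t H : ℝ} (hH : 0 < H) (hx : footParam γ I x = t) (hy : footParam γ I y = t + 2 * H)
    (hxy : ∀ p ∈ seg x y, footParam γ I p ∈ Icc t (t + 2 * H))
    (hcon : ∀ p, dist (γ t) p ≤ 7 * H → ∀ q, dist p q < height γ I p →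
      |footParam γ I p - footParam γ I q| ≤ H / (600 * 2401)) :
    ∃ w ∈ seg x y, height γ I w < 5 * H := by
  by_contra! hfar
  obtain ⟨m, hm, hmin⟩ := (isCompact_seg hX x y).exists_isMinOn ⟨x, left_mem_seg x y⟩
    hγ.continuous_height.continuousOn
  have htI : t ∈ I := hx ▸ hγ.footParam_mem x
  -- One endpoint projects at distance at least `H` from the projection of the lowest point `m`. The
  -- bound `5 * H` supplies `d(m₀, z₀) ≤ 4H ≤ height m - H`.
  have key : ∀ e ∈ seg x y, seg m e ⊆ seg x y → H ≤ |footParam γ I m - footParam γ I e| →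
      False := by
    intro e he hsub hge
    have hmr := hxy m hm
    have her := hxy e he
    have hle : |footParam γ I m - footParam γ I e| ≤ 2 * H := by
      rw [abs_le]; constructor <;> linarith [hmr.1, hmr.2, her.1, her.2]
    have hfm := hfar m hm
    have hfe := hfar e he
    obtain ⟨m₀, hm₀, hm₀d⟩ := exists_mem_seg_dist_eq hX (x := m) (y := γ (footParam γ I m))
      (p := height γ I m - H) (by linarith) (by unfold height; linarith)
    obtain ⟨z₀, hz₀, hz₀d⟩ := exists_mem_seg_dist_eq hX (x := e) (y := γ (footParam γ I e))
      (p := height γ I e - H) (by linarith) (by unfold height; linarith)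
    have hm₀H := hγ.height_of_mem_seg hX hm₀
    have hz₀H := hγ.height_of_mem_seg hX hz₀
    have hm₀φ := hγ.footParam_of_mem_seg hX hm₀
    have hz₀φ := hγ.footParam_of_mem_seg hX hz₀
    have hm₀H' : height γ I m₀ = H := by linarith
    have hz₀H' : height γ I z₀ = H := by linarith
    rw [← hm₀φ, ← hz₀φ] at hge hle
    have hL := hγ.dist_le_heights m₀ z₀
    have hcon' : ∀ p ∈ seg m₀ z₀, ∀ q, dist p q < height γ I p →
        |footParam γ I p - footParam γ I q| ≤ H / (600 * 2401) := by
      intro p hp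
      refine hcon p ?_
      have h1 := dist_triangle4 (γ t) (γ (footParam γ I m₀)) m₀ p
      have h2 : dist (γ t) (γ (footParam γ I m₀)) ≤ 2 * H := by
        rw [hγ.isGeodesic _ htI _ (hγ.footParam_mem m₀), hm₀φ, abs_le]
        constructor <;> linarith [hmr.1, hmr.2]
      have h3 : dist (γ (footParam γ I m₀)) m₀ = H := by rw [dist_comm]; exact hm₀H'
      have h4 : dist m₀ p ≤ dist m₀ z₀ := by
        rw [mem_seg_iff] at hp
        linarith [dist_nonneg (x := p) (y := z₀)]
      linarith
    obtain ⟨w, hw, hwH, hwd⟩ := hγ.exists_dip hX hH hm₀H' hz₀H' hge hle hcon'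
    obtain ⟨w', hw', hwH', hwd'⟩ := hγ.exists_dip hX hH hz₀H' hm₀H'
      (by rwa [abs_sub_comm]) (by rwa [abs_sub_comm]) (by rwa [seg_comm])
    obtain ⟨u, hu, hlt⟩ := hγ.exists_height_lt_of_dip hX hH hm₀ hm₀H' hz₀ hz₀H' (by linarith)
      hw hwH hwd (seg_comm m₀ z₀ ▸ hw') hwH' hwd'
    exact absurd (hmin (hsub hu)) (not_le.2 hlt)
  have hmr := hxy m hm
  rcases le_total (footParam γ I m) (t + H) with h | h
  · refine key y (right_mem_seg x y) (seg_subset_right hm) ?_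
    rw [hy, abs_sub_comm, le_abs]
    left; linarith
  · refine key x (left_mem_seg x y) (seg_comm x m ▸ seg_subset_left hm) ?_
    rw [hx, le_abs]
    left; linarith

/-- Cutting a segment down so that a function stays between its values at the endpoints. -/
theorem exists_subseg (hX : IsCAT0 X) {φ : X → ℝ} (hφ : Continuous φ) {x y : X} {t t' : ℝ}
    (hx : φ x ≤ t) (htt : t ≤ t') (hy : t' ≤ φ y) :
    ∃ x' y', seg x' y' ⊆ seg x y ∧ φ x' = t ∧ φ y' = t' ∧ ∀ p ∈ seg x' y', φ p ∈ Icc t t' := by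
  obtain ⟨v, hv, hvt⟩ := exists_eq_of_isPreconnected (isPreconnected_seg hX x y) hφ
    (left_mem_seg x y) (right_mem_seg x y) (hx.trans htt) hy
  have hc1 : IsCompact (seg x y ∩ φ ⁻¹' {t'}) :=
    (isCompact_seg hX x y).inter_right (isClosed_singleton.preimage hφ)
  -- `y'` is the first point at level `t'`, and `x'` the last point at level `t` before it.
  obtain ⟨y', ⟨hy', hy't⟩, hymin⟩ := hc1.exists_isMinOn ⟨v, hv, hvt⟩
    (f := fun p => dist x p) (continuous_const.dist continuous_id).continuousOn
  have hy't : φ y' = t' := hy't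
  obtain ⟨u, hu, hut⟩ := exists_eq_of_isPreconnected (isPreconnected_seg hX x y') hφ
    (left_mem_seg x y') (right_mem_seg x y') hx (htt.trans hy't.ge)
  have hc2 : IsCompact (seg x y' ∩ φ ⁻¹' {t}) :=
    (isCompact_seg hX x y').inter_right (isClosed_singleton.preimage hφ)
  obtain ⟨x', ⟨hx', hx't⟩, hxmin⟩ := hc2.exists_isMinOn ⟨u, hu, hut⟩
    (f := fun p => dist p y') (continuous_id.dist continuous_const).continuousOn
  have hx't : φ x' = t := hx't
  refine ⟨x', y', (seg_subset_right hx').trans (seg_subset_left hy'), hx't, hy't,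
    fun p hp => ⟨?_, ?_⟩⟩
  · by_contra! hlt
    obtain ⟨z, hz, hzt⟩ := exists_eq_of_isPreconnected (isPreconnected_seg hX p y') hφ
      (left_mem_seg p y') (right_mem_seg p y') hlt.le (htt.trans hy't.ge)
    have hzS := seg_subset_right hp hz
    have h1 : dist x' y' ≤ dist z y' := hxmin ⟨seg_subset_right hx' hzS, hzt⟩
    rw [mem_seg_iff] at hz hp
    have h2 : dist x' p = 0 := by
      linarith [dist_nonneg (x := x') (y := p), dist_nonneg (x := p) (y := z)]
    rw [← dist_eq_zero.1 h2, hx't] at hlt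
    exact lt_irrefl _ hlt
  · by_contra! hlt
    obtain ⟨z, hz, hzt⟩ := exists_eq_of_isPreconnected (isPreconnected_seg hX x' p) hφ
      (left_mem_seg x' p) (right_mem_seg x' p) (hx't.le.trans htt) hlt.le
    have hzS := seg_subset_left hp hz
    have hzS' := seg_subset_right hx' hzS
    have h1 : dist x y' ≤ dist x z := hymin ⟨seg_subset_left hy' hzS', hzt⟩
    rw [mem_seg_iff] at hzS'
    have h2 : dist z y' = 0 := by linarith [dist_nonneg (x := z) (y := y')]
    have h3 : dist p y' = 0 := by
      rw [mem_seg_iff] at hz hp hzS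
      linarith [dist_nonneg (x := z) (y := p), dist_nonneg (x := p) (y := y')]
    rw [dist_eq_zero.1 h3, hy't] at hlt
    exact lt_irrefl _ hlt

/-- A curtain joining points with distant projections to `γ` comes close to `γ` in between. -/
theorem Curtain.exists_mem_height_le (hX : IsCAT0 X) (hγ : IsClosedGeodesic γ I) {k : Curtain X}
    {x y : X} (hx : x ∈ k.carrier) (hy : y ∈ k.carrier) {r H : ℝ} (hr : r ∈ I) (hH : 1 ≤ H)
    (hxr : footParam γ I x ≤ r + 1 / 2) (hyr : r + 6 * H - 1 / 2 ≤ footParam γ I y)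
    (hcon : ∀ p, dist (γ r) p ≤ 11 * H → ∀ q, dist p q < height γ I p →
      |footParam γ I p - footParam γ I q| ≤ H / (600 * 2401)) :
    ∃ w ∈ k.carrier, height γ I w ≤ 5 * H ∧ footParam γ I w ∈ Icc r (r + 6 * H) := by
  have hk := k.isClosedGeodesic
  have hφ := hγ.continuous_footParam hX
  rw [k.carrier_eq hX] at hx hy ⊢
  have hsegx : seg x (k.γ (k.foot x)) ⊆ {x | k.foot x ∈ Icc (k.r - 1 / 2) (k.r + 1 / 2)} := by
    intro v hv
    rw [mem_ofPred_eq, show k.foot v = k.foot x from hk.footParam_of_mem_seg hX hv]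
    exact hx
  have hsegy : seg (k.γ (k.foot y)) y ⊆ {x | k.foot x ∈ Icc (k.r - 1 / 2) (k.r + 1 / 2)} := by
    intro v hv
    rw [seg_comm] at hv
    rw [mem_ofPred_eq, show k.foot v = k.foot y from hk.footParam_of_mem_seg hX hv]
    exact hy
  have main : ∀ (x₁ y₁ : X) (t : ℝ), r ≤ t → t ≤ r + 4 * H → footParam γ I x₁ ≤ t →
      t + 2 * H ≤ footParam γ I y₁ → t + 2 * H ≤ r + 6 * H →
      ∃ w ∈ seg x₁ y₁, height γ I w ≤ 5 * H ∧ footParam γ I w ∈ Icc r (r + 6 * H) := by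
    intro x₁ y₁ t hrt htr hx₁ hy₁ htop
    obtain ⟨x₂, y₂, hsub, hx₂, hy₂, hin⟩ := exists_subseg hX hφ hx₁
      (show t ≤ t + 2 * H by linarith) hy₁
    obtain ⟨w, hw, hwH⟩ := hγ.exists_height_lt hX (by linarith) hx₂ hy₂ hin fun p hp => by
      refine hcon p ?_
      have h1 := dist_triangle (γ r) (γ t) p
      rw [hγ.isGeodesic r hr t (hx₂ ▸ hγ.footParam_mem x₂), abs_sub_comm,
        abs_of_nonneg (by linarith)] at h1
      linarith
    exact ⟨w, hsub hw, hwH.le, by linarith [(hin w hw).1], by linarith [(hin w hw).2]⟩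
  -- A curtain need not be convex, so the path from `x` to `y` runs through the pole. The pole part
  -- has length at most `1`, so one of the two perpendiculars projects across an interval of length
  -- `2H`.
  rcases le_total (r + 1 / 2 + 2 * H) (footParam γ I (k.γ (k.foot x))) with h | h
  · obtain ⟨w, hw, hw'⟩ := main x _ (r + 1 / 2) (by linarith) (by linarith) hxr h (by linarith)
    exact ⟨w, hsegx hw, hw'⟩
  · have hpq : dist (k.γ (k.foot y)) (k.γ (k.foot x)) ≤ 1 := by
      rw [k.isGeodesic (k.foot y) (hk.footParam_mem y) (k.foot x) (hk.footParam_mem x), abs_le]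
      have h1 := hx.1
      have h2 := hx.2
      have h3 := hy.1
      have h4 := hy.2
      constructor <;> linarith
    have := (abs_le.1 (hγ.abs_footParam_sub_le hX (k.γ (k.foot y)) (k.γ (k.foot x)))).2
    obtain ⟨w, hw, hw'⟩ := main (k.γ (k.foot y)) y (r + 3 / 2 + 2 * H) (by linarith) (by linarith)
      (by linarith) (by linarith) (by linarith)
    exact ⟨w, hsegy hw, hw'⟩

end Contraction

/-! ### Contracting rays are curtain-excursion -/

theorem IsKappaContracting.curtainExcursion (hX : IsCAT0 X) {κ : ℝ → ℝ} (hκ : IsSublinear κ)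
    {b : ℝ → X} (hb : IsGeodesicRay b) (h : IsKappaContracting κ b) :
    Curtain.IsKappaCurtainExcursion κ b := by
  obtain ⟨C, hC, hcon⟩ := h
  have hγ := hb.isClosedGeodesic
  obtain ⟨M, hM, hscale⟩ := hκ.exists_scale (D := C * (600 * 2401)) (t₀ := 0) (by positivity)
    le_rfl (n := 20) (by norm_num)
  have hcontr : ∀ t, 0 ≤ t → ∀ p, dist (b t) p ≤ 11 * (M * κ t) → ∀ q,
      dist p q < height b (Ici 0) p →
      |footParam b (Ici 0) p - footParam b (Ici 0) q| ≤ M * κ t / (600 * 2401) := by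
    intro t ht p hp q hpq
    have hdisj : Disjoint (Metric.ball p (height b (Ici 0) p)) (b '' Ici 0) := by
      rw [Set.disjoint_right]
      rintro _ ⟨s, hs, rfl⟩ hmem
      rw [Metric.mem_ball, dist_comm] at hmem
      exact absurd (hγ.dist_footParam_le p hs) (not_le.2 hmem)
    have hpos : 0 < height b (Ici 0) p := dist_nonneg.trans_lt hpq
    have h1 := hcon p _ hdisj
    have h2 := Metric.edist_le_ediam_of_mem
      (s := projImage (b '' Ici 0) (Metric.ball p (height b (Ici 0) p)))
      (x := b (footParam b (Ici 0) p)) (y := b (footParam b (Ici 0) q))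
      ⟨p, Metric.mem_ball_self hpos, (hγ.footParam_spec p).2⟩
      ⟨q, by rwa [Metric.mem_ball, dist_comm], (hγ.footParam_spec q).2⟩
    have h3 := h2.trans h1.le
    have hκp := hκ.one_le (dist (b 0) p) dist_nonneg
    rw [edist_dist, ENNReal.ofReal_le_ofReal_iff (by positivity),
      hb _ (hγ.footParam_mem p) _ (hγ.footParam_mem q)] at h3
    have hκt := hκ.one_le t ht
    have hMt : 0 ≤ M * κ t := by positivity
    have h4 : κ (dist (b 0) p) ≤ κ (t + 0 + 20 * M * κ t) := by
      refine hκ.monotone dist_nonneg (show (0 : ℝ) ≤ _ by positivity) ?_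
      have h5 := dist_triangle (b 0) (b t) p
      rw [hb 0 self_mem_Ici t ht, zero_sub, abs_neg, abs_of_nonneg ht] at h5
      linarith
    have h6 := hscale t ht
    have h7 := mul_le_mul_of_nonneg_left h4 hC
    rw [le_div_iff₀ (by norm_num)]
    linarith
  -- Starting at `1` keeps every pole in the interior of `[0, ∞)`; the step `6H` is the width used
  -- by `Curtain.exists_mem_height_le`.
  let t : ℕ → ℝ := fun n => Nat.rec 1 (fun _ s => s + 6 * (M * κ s)) n
  have ht0 : t 0 = 1 := rfl
  have hts : ∀ i, t (i + 1) = t i + 6 * (M * κ (t i)) := fun i => rfl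
  have ht1 : ∀ i, 1 ≤ t i := by
    intro i
    induction i with
    | zero => exact ht0.ge
    | succ i ih =>
      have := hκ.one_le (t i) (by linarith)
      rw [hts]
      have : 0 ≤ M * κ (t i) := by positivity
      linarith
  have hH : ∀ i, 1 ≤ M * κ (t i) := fun i =>
    one_le_mul_of_one_le_of_one_le hM (hκ.one_le _ (by linarith [ht1 i]))
  have hstep : ∀ i, t i + 1 < t (i + 1) := fun i => by rw [hts]; linarith [hH i]
  have hmono : StrictMono t := strictMono_nat_of_lt_succ fun i => by linarith [hstep i]
  let k : ℕ → Curtain X := fun i =>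
    { γ := b
      I := Ici 0
      r := t i
      isClosed := isClosed_Ici
      ordConnected := ordConnected_Ici
      isGeodesic := hb
      subset_interior := by
        rw [interior_Ici]
        intro s hs
        exact mem_Ioi.2 (by linarith [hs.1, ht1 i]) }
  have hfoot : ∀ i, (k i).foot = footParam b (Ici 0) := fun i => rfl
  have hchain : Curtain.IsChainOfLength ⊤ k := by
    refine Curtain.isChainOfLength_of_dual hX hfoot fun i j _ hij => ?_
    show t i + 1 < t j
    exact (hstep i).trans_le (hmono.monotone hij)
  have hcar : ∀ i x, x ∈ (k i).carrier ↔
      footParam b (Ici 0) x ∈ Icc (t i - 1 / 2) (t i + 1 / 2) := fun i x => by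
    rw [(k i).carrier_eq hX]; rfl
  have hκt : ∀ i, κ (t i) ≤ κ (t (i + 1)) := fun i =>
    hκ.monotone (mem_Ici.2 (by linarith [ht1 i])) (mem_Ici.2 (by linarith [ht1 (i + 1)]))
      (by linarith [hstep i])
  have hMκ : ∀ i, M * κ (t i) ≤ M * κ (t (i + 1)) := fun i =>
    mul_le_mul_of_nonneg_left (hκt i) (by linarith)
  refine ⟨20 * M, by linarith, k, t, ⟨hchain, fun i => by linarith [ht1 i], fun i => ?_,
    fun i => ?_, fun i => ⟨?_, fun N g hg hmeet => ?_⟩⟩, fun i => ⟨rfl, fun _ _ => rfl, rfl⟩⟩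
  · exact (k i).center_mem hX
  · rw [hts i]
    have := hMκ i
    have := hH i
    rw [← hts i]
    linarith
  · exact hchain.1 i (i + 1) (ENat.natCast_lt_top _) (ENat.natCast_lt_top _) (by omega)
  · have hex : ∀ j : ℕ, ∃ w, (j : ℕ∞) < N → w ∈ (g j).carrier ∧
        height b (Ici 0) w ≤ 5 * (M * κ (t i)) ∧
        footParam b (Ici 0) w ∈ Icc (t i) (t i + 6 * (M * κ (t i))) := by
      intro j
      by_cases hj : (j : ℕ∞) < N
      · obtain ⟨⟨x, hxg, hxk⟩, ⟨y, hyg, hyk⟩⟩ := hmeet j hj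
        replace hxk := (hcar i x).1 hxk
        replace hyk := (hcar (i + 1) y).1 hyk
        rw [hts] at hyk
        obtain ⟨w, hw⟩ := Curtain.exists_mem_height_le hX hγ hxg hyg
          (mem_Ici.2 (by linarith [ht1 i])) (hH i) hxk.2 hyk.1 (hcontr (t i) (by linarith [ht1 i]))
        exact ⟨w, fun _ => hw⟩
      · exact ⟨b 0, fun h => absurd h hj⟩
    choose w hw using hex
    -- Two heights of at most `5H` and a horizontal part of at most `6H`.
    obtain ⟨n, hn, hle⟩ := hg.exists_length_le hX (D := 16 * (M * κ (t i))) (w := w)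
      (fun j hj => (hw j hj).1) (fun j l hj hl => by
        have h1 := hγ.dist_le_heights (w j) (w l)
        obtain ⟨-, a1, a2, a3⟩ := hw j hj
        obtain ⟨-, b1, b2, b3⟩ := hw l hl
        have h2 : |footParam b (Ici 0) (w j) - footParam b (Ici 0) (w l)| ≤ 6 * (M * κ (t i)) := by
          rw [abs_le]; constructor <;> linarith
        linarith) (by linarith [hH i])
    refine ⟨n, hn, ?_⟩
    have := hMκ i
    have := hH i
    linarith

/-! ## Rays meeting a chain of separated curtains -/

/-- A point of a curtain lying between points of two further curtains, each of them separated from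
it, is close to every geodesic meeting the three curtains. -/
theorem Curtain.height_le_of_between (hX : IsCAT0 X) {γ : ℝ → X} {I : Set ℝ}
    (hγ : IsClosedGeodesic γ I) {L : ℝ} {h₁ h₂ h₃ : Curtain X} (h12 : LSeparated L h₁ h₂)
    (h23 : LSeparated L h₂ h₃) {s₁ s₂ s₃ : ℝ} (hs₁ : s₁ ∈ I) (hs₂ : s₂ ∈ I) (hs₃ : s₃ ∈ I)
    (hb₁ : γ s₁ ∈ h₁.carrier) (hb₂ : γ s₂ ∈ h₂.carrier) (hb₃ : γ s₃ ∈ h₃.carrier) {u z v : X}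
    (hu : u ∈ h₁.carrier) (hz : z ∈ h₂.carrier) (hv : v ∈ h₃.carrier) (hzuv : z ∈ seg u v) :
    height γ I z ≤ 2 * L + 4 := by
  set q := γ (footParam γ I z) with hq
  obtain ⟨g, hg⟩ := hX.exists_geodesic q z
  have hσ := hg.isClosedGeodesic
  set ℓ := dist q z with hℓ
  have hℓH : height γ I z = ℓ := dist_comm _ _
  have hℓ0 : 0 ≤ ℓ := dist_nonneg
  have hseg : seg q z = g '' Icc 0 ℓ := seg_eq_image hX hg
  have hg0 : g 0 = q := hg.2.1
  have hgℓ : g ℓ = z := hg.2.2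
  have h0m : (0 : ℝ) ∈ Icc 0 ℓ := ⟨le_rfl, hℓ0⟩
  have hℓm : ℓ ∈ Icc 0 ℓ := ⟨hℓ0, le_rfl⟩
  -- the geodesic `γ` projects to `q`
  have hγ0 : ∀ s ∈ I, footParam g (Icc 0 ℓ) (γ s) = 0 := by
    -- Each point `w` of `[q, z]` projects to `q` on `γ`, so the right angle at `q` gives `d(γ s, q)
    -- ≤ d(γ s, w)`.
    intro s hs
    refine (hσ.footParam_eq_iff hX h0m).1 ⟨mem_image_of_mem _ h0m, ?_⟩
    rw [← hseg, hg0]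
    intro w hw
    rw [seg_comm] at hw
    have hwφ : footParam γ I w = footParam γ I z := hγ.footParam_of_mem_seg hX hw
    have := hγ.sq_dist_ge hX (hγ.footParam_mem w) (hγ.footParam_spec w).2 hs
    rw [hwφ, ← hq] at this
    rw [dist_comm (γ s) q, dist_comm (γ s) w]
    exact le_of_sq_le_sq (by nlinarith [sq_nonneg (dist w q)]) dist_nonneg
  have hzℓ : footParam g (Icc 0 ℓ) z = ℓ := by
    conv_lhs => rw [← hgℓ]
    exact hσ.footParam_apply hX hℓm
  -- one of `u`, `v` projects to `z`
  have huv : footParam g (Icc 0 ℓ) u = ℓ ∨ footParam g (Icc 0 ℓ) v = ℓ := by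
    by_contra! hcon
    have key : ∀ p, footParam g (Icc 0 ℓ) p ≠ ℓ →
        ∃ l, 0 < l ∧ l ≤ 1 ∧ ∀ l', 0 < l' → l' ≤ l → ∀ w, DividesAt l' z q w →
          dist p w < dist p z := by
      intro p hp
      have hne : ¬ IsNearestPoint (g '' Icc 0 ℓ) p (g ℓ) := fun h =>
        hp ((hσ.footParam_eq_iff hX hℓm).1 h)
      rw [IsNearestPoint, ← hseg, hgℓ] at hne
      have : ∃ w ∈ seg q z, dist p w < dist p z := by
        by_contra! hall
        exact hne ⟨right_mem_seg q z, hall⟩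
      obtain ⟨w, hw, hwlt⟩ := this
      rw [seg_comm] at hw
      obtain ⟨l, hl⟩ := DividesAt.exists_of_dist hw
      have hl0 : 0 < l := by
        refine hl.nonneg.lt_of_ne ?_
        rintro rfl
        have := hl.dist_left
        rw [zero_mul] at this
        rw [dist_eq_zero.1 this] at hwlt
        exact lt_irrefl _ hwlt
      refine ⟨l, hl0, hl.le_one, fun l' hl'0 hl'l w' hw' => ?_⟩
      have hw'w : DividesAt (l' / l) z w w' := by
        have hzw' : w' ∈ seg z w := by
          have h1 : w' ∈ seg z q := by
            rw [mem_seg_iff, hw'.dist_left, hw'.dist_right]; ring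
          refine seg_ordered hX h1 hw ?_
          rw [hw'.dist_left, hl.dist_left]
          exact mul_le_mul_of_nonneg_right hl'l dist_nonneg
        have e : dist z w' = l' / l * dist z w := by
          rw [hw'.dist_left, hl.dist_left]; field_simp
        refine ⟨by positivity, by rw [div_le_one hl0]; exact hl'l, e, ?_⟩
        rw [mem_seg_iff] at hzw'
        linarith
      have hc := hX.dist_vertex_le p hw'w
      rw [dist_comm w' p, dist_comm z p, dist_comm w p] at hc
      have hpos : 0 < l' / l := by positivity
      nlinarith
    obtain ⟨l₁, h1, h1', hl₁⟩ := key u hcon.1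
    obtain ⟨l₂, h2, h2', hl₂⟩ := key v hcon.2
    obtain ⟨w, hw⟩ := hX.exists_dividesAt z q (l := min l₁ l₂) (le_min h1.le h2.le)
      ((min_le_left _ _).trans h1')
    have a := hl₁ _ (lt_min h1 h2) (min_le_left _ _) w hw
    have b := hl₂ _ (lt_min h1 h2) (min_le_right _ _) w hw
    have c := dist_triangle u w v
    rw [mem_seg_iff] at hzuv
    rw [dist_comm v w, dist_comm v z] at b
    linarith
  rw [hℓH]
  have main : ∀ (h h' : Curtain X) (s s' : ℝ) (p p' : X), LSeparated L h h' → s ∈ I → s' ∈ I →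
      γ s ∈ h.carrier → γ s' ∈ h'.carrier → p ∈ h.carrier → p' ∈ h'.carrier →
      footParam g (Icc 0 ℓ) p = ℓ → footParam g (Icc 0 ℓ) p' = ℓ → ℓ ≤ 2 * L + 4 := by
    intro h h' s s' p p' hsep hs hs' hb hb' hp hp' e e'
    have := hsep.overlap_le hX hσ hb hp hb' hp' (hγ0 s hs).le e.ge (hγ0 s' hs').le e'.ge
    linarith
  rcases huv with h | h
  · exact main h₁ h₂ s₁ s₂ u z h12 hs₁ hs₂ hb₁ hb₂ hu hz h hzℓ
  · exact main h₂ h₃ s₂ s₃ z v h23 hs₂ hs₃ hb₂ hb₃ hz hv hzℓ h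

/-- A `κ`-chain met by `b`, with its curtains described by nested oriented walls. -/
structure NestedWallChain (κ : ℝ → ℝ) (C : ℝ) (b : ℝ → X) (h : ℕ → Curtain X) (t : ℕ → ℝ)
    (χ : ℕ → X → ℝ) : Prop where
  isWall : ∀ i, IsWall (χ i)
  mem_iff : ∀ i x, x ∈ (h i).carrier ↔ χ i x ∈ Icc (-1 / 2) (1 / 2)
  nested : ∀ i x, χ i x ≤ 1 / 2 → χ (i + 1) x < -1 / 2
  nonneg : ∀ i, 0 ≤ t i
  meets : ∀ i, b (t i) ∈ (h i).carrier
  gap : ∀ i, t (i + 1) - t i ≤ C * κ (t (i + 1))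
  separated : ∀ i, Curtain.LSeparated (C * κ (t (i + 1))) (h i) (h (i + 1))

/-- Only curtains with both neighbours get an oriented wall, so the chain is shifted by one. -/
theorem Curtain.IsKappaChain.exists_nestedWallChain (hX : IsCAT0 X) {κ : ℝ → ℝ} {C : ℝ}
    {b : ℝ → X} {h : ℕ → Curtain X} {t : ℕ → ℝ} (hc : Curtain.IsKappaChain κ C b h t) :
    ∃ χ, NestedWallChain κ C b (fun i => h (i + 1)) (fun i => t (i + 1)) χ := by
  obtain ⟨χ, h1, h2⟩ := hc.chain.exists_walls hX
  exact ⟨χ, fun i => (h1 i (ENat.natCast_lt_top _)).1, fun i => (h1 i (ENat.natCast_lt_top _)).2,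
    fun i => h2 i (ENat.natCast_lt_top _), fun i => hc.nonneg _, fun i => hc.meets _,
    fun i => hc.gap _, fun i => hc.separated _⟩

namespace NestedWallChain

variable {κ : ℝ → ℝ} {C : ℝ} {b : ℝ → X} {h : ℕ → Curtain X} {t : ℕ → ℝ} {χ : ℕ → X → ℝ}

theorem lt_of_lt (hc : NestedWallChain κ C b h t χ) {i j : ℕ} (hij : i < j) {x : X}
    (hx : χ i x ≤ 1 / 2) : χ j x < -1 / 2 :=
  nested_walls (n := j) (fun m _ => hc.nested m) hij le_rfl hx

theorem lt_of_gt (hc : NestedWallChain κ C b h t χ) {i j : ℕ} (hij : i < j) {x : X}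
    (hx : -1 / 2 ≤ χ j x) : 1 / 2 < χ i x := by
  by_contra! hcon
  linarith [hc.lt_of_lt hij hcon]

/-- A connected set crossing two consecutive walls meets both curtains, as does `b` at times `t i`
and `t (i + 1)`. Bounded overlap then keeps the set from projecting entirely far beyond or far
before these times. -/
theorem sub_le_of_crossing (hX : IsCAT0 X) (hb : IsGeodesicRay b)
    (hc : NestedWallChain κ C b h t χ) {i : ℕ} {S : Set X} (hS : IsPreconnected S) {x y : X}
    (hx : x ∈ S) (hy : y ∈ S) (h1 : χ i x ≤ 1 / 2) (h2 : χ (i + 1) x ≤ 1 / 2)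
    (h3 : -1 / 2 ≤ χ i y) (h4 : -1 / 2 ≤ χ (i + 1) y) :
    (∀ s, (∀ p ∈ S, s ≤ footParam b (Ici 0) p) →
      s ≤ max (t i) (t (i + 1)) + (2 * (C * κ (t (i + 1))) + 4)) ∧
    ∀ s, (∀ p ∈ S, footParam b (Ici 0) p ≤ s) →
      min (t i) (t (i + 1)) ≤ s + (2 * (C * κ (t (i + 1))) + 4) := by
  have hγ := hb.isClosedGeodesic
  have cross : ∀ j, χ j x ≤ 1 / 2 → -1 / 2 ≤ χ j y → ∃ z ∈ S, z ∈ (h j).carrier := by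
    intro j hjx hjy
    rcases le_total (-1 / 2) (χ j x) with hx' | hx'
    · exact ⟨x, hx, (hc.mem_iff j x).2 ⟨hx', hjx⟩⟩
    · obtain ⟨z, hz, hz0⟩ := exists_eq_of_isPreconnected hS (hc.isWall j).continuous hx hy hx' hjy
      exact ⟨z, hz, (hc.mem_iff j z).2 (by rw [hz0]; constructor <;> norm_num)⟩
  obtain ⟨z, hz, hzh⟩ := cross i h1 h3
  obtain ⟨z', hz', hzh'⟩ := cross (i + 1) h2 h4
  have e1 := hγ.footParam_apply hX (mem_Ici.2 (hc.nonneg i))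
  have e2 := hγ.footParam_apply hX (mem_Ici.2 (hc.nonneg (i + 1)))
  constructor
  · intro s hs
    have := (hc.separated i).overlap_le hX hγ (hc.meets i) hzh (hc.meets (i + 1)) hzh'
      (e1.trans_le (le_max_left _ _)) (hs z hz) (e2.trans_le (le_max_right _ _)) (hs z' hz')
    linarith
  · intro s hs
    have := (hc.separated i).overlap_le hX hγ hzh (hc.meets i) hzh' (hc.meets (i + 1))
      (hs z hz) ((min_le_left _ _).trans e1.ge) (hs z' hz') ((min_le_right _ _).trans e2.ge)
    linarith

end NestedWallChain

theorem Curtain.LSeparated.mono {L L' : ℝ} {h h' : Curtain X} (hs : Curtain.LSeparated L h h')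
    (hL : L ≤ L') : Curtain.LSeparated L' h h' :=
  ⟨hs.1, fun N k hk hm => by
    obtain ⟨n, hn, hle⟩ := hs.2 N k hk hm
    exact ⟨n, hn, hle.trans hL⟩⟩

/-- The path from `x` to its projection and then along the geodesic. -/
theorem IsClosedGeodesic.exists_isPreconnected (hX : IsCAT0 X) {γ : ℝ → X} {I : Set ℝ}
    (hγ : IsClosedGeodesic γ I) (x : X) {s : ℝ} (hs : s ∈ I) :
    ∃ S : Set X, IsPreconnected S ∧ x ∈ S ∧ γ s ∈ S ∧
      ∀ p ∈ S, footParam γ I p ∈ uIcc (footParam γ I x) s := by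
  have hsub : uIcc (footParam γ I x) s ⊆ I := hγ.ordConnected.uIcc_subset (hγ.footParam_mem x) hs
  refine ⟨seg x (γ (footParam γ I x)) ∪ γ '' uIcc (footParam γ I x) s, ?_,
    Or.inl (left_mem_seg _ _), Or.inr (mem_image_of_mem _ right_mem_uIcc), ?_⟩
  · exact IsPreconnected.union (γ (footParam γ I x)) (right_mem_seg _ _)
      (mem_image_of_mem _ left_mem_uIcc) (isPreconnected_seg hX _ _)
      (isPreconnected_uIcc.image _ (hγ.isGeodesic.continuousOn.mono hsub))
  · rintro p (hp | ⟨r, hr, rfl⟩)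
    · rw [hγ.footParam_of_mem_seg hX hp]; exact left_mem_uIcc
    · rw [hγ.footParam_apply hX (hsub hr)]; exact hr

namespace NestedWallChain

variable {κ : ℝ → ℝ} {C : ℝ} {b : ℝ → X} {h : ℕ → Curtain X} {t : ℕ → ℝ} {χ : ℕ → X → ℝ}

/-- The times need not be monotone; they diverge because the number of walls between `b (t 0)` and
`b (t j)` grows with `j`. -/
theorem exists_forall_lt (hX : IsCAT0 X) (hb : IsGeodesicRay b)
    (hc : NestedWallChain κ C b h t χ) (A : ℝ) : ∃ n, ∀ j, n ≤ j → A < t j := by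
  obtain ⟨n, hn⟩ := exists_nat_gt (A + t 0)
  refine ⟨n + 1, fun j hj => ?_⟩
  obtain ⟨m, rfl⟩ := Nat.exists_eq_add_of_le' (show 1 ≤ j by omega)
  have h1 := le_dist_of_walls hX (χ := χ) (i := 0) (j := m) (fun i _ => hc.isWall i)
    (fun i _ => hc.nested i) (x := b (t 0)) (y := b (t (m + 1)))
    ((hc.mem_iff 0 _).1 (hc.meets 0)).2
    (by rw [Nat.zero_add]; exact ((hc.mem_iff (m + 1) _).1 (hc.meets (m + 1))).1)
  rw [hb _ (mem_Ici.2 (hc.nonneg 0)) _ (mem_Ici.2 (hc.nonneg (m + 1)))] at h1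
  have h2 : |t 0 - t (m + 1)| ≤ t 0 + t (m + 1) := by
    rw [abs_le]; constructor <;> linarith [hc.nonneg 0, hc.nonneg (m + 1)]
  have h3 : (n : ℝ) ≤ m := by exact_mod_cast (by omega : n ≤ m)
  linarith

/-- A point projecting to `b` well beyond a curtain lies on its far side. -/
theorem lt_of_lt_footParam (hX : IsCAT0 X) (hb : IsGeodesicRay b)
    (hc : NestedWallChain κ C b h t χ) {i : ℕ} {x : X}
    (hx : max (t i) (t (i + 1)) + (2 * (C * κ (t (i + 1))) + 4) < footParam b (Ici 0) x) :
    1 / 2 < χ i x := by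
  by_contra! hcon
  obtain ⟨n, hn⟩ := hc.exists_forall_lt hX hb (footParam b (Ici 0) x)
  -- The path from `x` to `b (t j)` projects beyond `x`'s foot and must cross both walls `i` and `i
  -- + 1`.
  set j := max n (i + 2) with hj
  have hjt := hn j (le_max_left _ _)
  have hij : i + 2 ≤ j := le_max_right _ _
  obtain ⟨S, hS, hxS, hyS, hfoot⟩ := hb.isClosedGeodesic.exists_isPreconnected hX x
    (mem_Ici.2 (hc.nonneg j))
  have hy := ((hc.mem_iff j _).1 (hc.meets j)).1
  have h2 := hc.lt_of_lt (Nat.lt_succ_self i) hcon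
  have h3 := hc.lt_of_gt (show i < j by omega) hy
  have h4 := hc.lt_of_gt (show i + 1 < j by omega) hy
  have := (hc.sub_le_of_crossing hX hb hS hxS hyS hcon (h2.le.trans (by norm_num))
    (by linarith) (by linarith)).1 (footParam b (Ici 0) x) fun p hp => by
      have := hfoot p hp
      rw [uIcc_of_le hjt.le] at this
      exact this.1
  linarith

/-- A point projecting to `b` well before a curtain lies on its near side. -/
theorem lt_of_footParam_lt (hX : IsCAT0 X) (hb : IsGeodesicRay b)
    (hc : NestedWallChain κ C b h t χ) {i : ℕ} (hi : 0 < i) {x : X}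
    (hx : max (footParam b (Ici 0) x) (t 0) + (2 * (C * κ (t (i + 1))) + 4) <
      min (t i) (t (i + 1))) : χ (i + 1) x < -1 / 2 := by
  by_contra! hcon
  obtain ⟨S, hS, hxS, hyS, hfoot⟩ := hb.isClosedGeodesic.exists_isPreconnected hX x
    (mem_Ici.2 (hc.nonneg 0))
  have hy := ((hc.mem_iff 0 _).1 (hc.meets 0)).2
  have h2 := hc.lt_of_gt (Nat.lt_succ_self i) hcon
  have h3 := hc.lt_of_lt hi hy
  have h4 := hc.lt_of_lt (show 0 < i + 1 by omega) hy
  have := (hc.sub_le_of_crossing hX hb hS hyS hxS (by linarith) (by linarith)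
    (by linarith) hcon).2 (max (footParam b (Ici 0) x) (t 0)) fun p hp => (hfoot p hp).2
  linarith

/-- Segments between points with distant projections pass close to `b`, far from both
projections. -/
theorem exists_between (hX : IsCAT0 X) (hκ : IsSublinear κ) (hb : IsGeodesicRay b) (hC : 0 < C)
    (hc : NestedWallChain κ C b h t χ) : ∃ E, 0 ≤ E ∧ ∀ R, 0 ≤ R → ∀ u v : X,
      footParam b (Ici 0) u ≤ R → footParam b (Ici 0) u + E * κ R < footParam b (Ici 0) v →
      ∃ z ∈ seg u v, ∃ W, height b (Ici 0) z ≤ W ∧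
        footParam b (Ici 0) u + W < footParam b (Ici 0) z ∧
        footParam b (Ici 0) z + W < footParam b (Ici 0) v := by
  classical
  obtain ⟨D, hD, hgap⟩ := hκ.exists_le_mul_of_gap hC
  have ht0 := hc.nonneg 0
  obtain ⟨Y, hY, hscale⟩ := hκ.exists_scale (D := 100 * ((1 + C) * D ^ 5)) (by positivity) ht0
    one_pos
  -- A margin of `Y κ(R)` is reserved on each side of `s₀`; the `t 0` pays for replacing `φ u` by
  -- `max (φ u) (t 0)`.
  refine ⟨t 0 + 2 * Y, by linarith, fun R hR u v hu huv => ?_⟩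
  set φ := footParam b (Ici 0) with hφ
  have hφ0 : ∀ x, 0 ≤ φ x := fun x => hb.isClosedGeodesic.footParam_mem x
  have hκR := hκ.one_le R hR
  have hYR : 0 ≤ Y * κ R := by positivity
  set s₀ := max (φ u) (t 0) + Y * κ R with hs₀
  have hs₀0 : t 0 ≤ s₀ := by linarith [le_max_right (φ u) (t 0)]
  set Q := κ (R + t 0 + 1 * Y * κ R) with hQ
  have hQ1 : 1 ≤ Q := hκ.one_le _ (by linarith)
  have hscaleR := hscale R hR
  have hκs₀ : κ s₀ ≤ Q := by
    refine hκ.monotone (mem_Ici.2 (ht0.trans hs₀0)) (mem_Ici.2 (by linarith)) ?_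
    have : max (φ u) (t 0) ≤ R + t 0 := max_le (by linarith) (by linarith)
    linarith
  obtain ⟨n, hn⟩ := hc.exists_forall_lt hX hb s₀
  -- Since the times may go back and forth, `j` is the last index with `t j ≤ s₀`.
  obtain ⟨j, hj, hjgt⟩ : ∃ j, t j ≤ s₀ ∧ ∀ k, j < k → s₀ < t k := by
    refine ⟨Nat.findGreatest (fun k => t k ≤ s₀) n,
      Nat.findGreatest_spec (P := fun k => t k ≤ s₀) (Nat.zero_le n) hs₀0, fun k hk => ?_⟩
    rcases Nat.lt_or_ge n k with hnk | hnk
    · exact hn k hnk.le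
    · exact not_le.1 (Nat.findGreatest_is_greatest hk hnk)
  have hκt : ∀ m, κ (t (j + m)) ≤ D ^ m * Q := by
    intro m
    induction m with
    | zero =>
      rw [pow_zero, one_mul]
      exact (hκ.monotone (mem_Ici.2 (hc.nonneg j)) (mem_Ici.2 (ht0.trans hs₀0)) hj).trans hκs₀
    | succ m ih =>
      have h1 := hgap _ _ (hc.nonneg (j + m)) (hc.nonneg (j + m + 1))
        (by linarith [hc.gap (j + m)])
      have h2 := mul_le_mul_of_nonneg_left ih (show 0 ≤ D by linarith)
      calc κ (t (j + m + 1)) ≤ D * κ (t (j + m)) := h1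
        _ ≤ D * (D ^ m * Q) := h2
        _ = D ^ (m + 1) * Q := by ring
  -- `G` bounds the gaps and separation constants of the next five curtains, since `κ` grows by at
  -- most a factor `D` per gap. The choice of `Y` makes all of this small against the margin.
  set G := C * (D ^ 5 * Q) with hG
  have hDQ : 1 ≤ D ^ 5 * Q := one_le_mul_of_one_le_of_one_le (one_le_pow₀ hD) hQ1
  have hG0 : 0 ≤ G := by positivity
  have hGY : 100 * G + 100 ≤ Y * κ R := by
    have : 100 * ((1 + C) * D ^ 5) * Q = 100 * (D ^ 5 * Q) + 100 * G := by rw [hG]; ring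
    linarith
  have hCG : ∀ m, m ≤ 5 → C * κ (t (j + m)) ≤ G := fun m hm => by
    refine mul_le_mul_of_nonneg_left ((hκt m).trans ?_) hC.le
    exact mul_le_mul_of_nonneg_right (pow_le_pow_right₀ hD hm) (by linarith)
  have G1 := hCG 1 (by norm_num)
  have G2 := hCG 2 (by norm_num)
  have G3 := hCG 3 (by norm_num)
  have G4 := hCG 4 (by norm_num)
  have G5 := hCG 5 (by norm_num)
  have T1 := hc.gap j
  have T2 := hc.gap (j + 1)
  have T3 := hc.gap (j + 2)
  have T4 := hc.gap (j + 3)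
  have T5 := hc.gap (j + 4)
  have hv : s₀ + Y * κ R < φ v := by
    have h1 : t 0 ≤ t 0 * κ R := le_mul_of_one_le_right ht0 hκR
    have h2 : max (φ u) (t 0) ≤ φ u + t 0 * κ R :=
      max_le (by linarith) (by linarith [hφ0 u])
    linarith
  have hu2 : χ (j + 2) u < -1 / 2 := by
    refine hc.lt_of_footParam_lt hX hb (Nat.succ_pos j) (lt_min ?_ ?_)
    · linarith [hjgt (j + 1) (by omega)]
    · linarith [hjgt (j + 2) (by omega)]
  have hv4 : 1 / 2 < χ (j + 4) v := by
    refine hc.lt_of_lt_footParam hX hb ?_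
    have : max (t (j + 4)) (t (j + 5)) ≤ s₀ + 5 * G := max_le (by linarith) (by linarith)
    linarith
  have hu3 := hc.lt_of_lt (show j + 2 < j + 3 by omega) (hu2.le.trans (by norm_num))
  have hv3 := hc.lt_of_gt (show j + 3 < j + 4 by omega) (x := v) (by linarith)
  -- The three curtains are `j + 2`, `j + 3` and `j + 4`, with `z` on the middle one.
  obtain ⟨z, hz, hz0⟩ := exists_eq_of_isPreconnected (isPreconnected_seg hX u v)
    (hc.isWall (j + 3)).continuous (left_mem_seg u v) (right_mem_seg u v) (v := 0)
    (by linarith) (by linarith)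
  have hz2 := hc.lt_of_gt (show j + 2 < j + 3 by omega) (x := z) (by linarith)
  have hz4 := hc.lt_of_lt (show j + 3 < j + 4 by omega) (x := z) (by linarith)
  obtain ⟨u', hu', hu'0⟩ := exists_eq_of_isPreconnected (isPreconnected_seg hX u z)
    (hc.isWall (j + 2)).continuous (left_mem_seg u z) (right_mem_seg u z) (v := 0)
    (by linarith) (by linarith)
  obtain ⟨v', hv', hv'0⟩ := exists_eq_of_isPreconnected (isPreconnected_seg hX z v)
    (hc.isWall (j + 4)).continuous (left_mem_seg z v) (right_mem_seg z v) (v := 0)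
    (by linarith) (by linarith)
  have hzuv : z ∈ seg u' v' := by
    have h1 := mem_seg_right_of_mem_left hz hu'
    rw [seg_comm] at h1 hv' ⊢
    exact mem_seg_right_of_mem_left h1 hv'
  have hmem : ∀ i x, χ i x = 0 → x ∈ (h i).carrier := fun i x hx =>
    (hc.mem_iff i x).2 (by rw [hx]; constructor <;> norm_num)
  have hheight := Curtain.height_le_of_between hX hb.isClosedGeodesic
    ((hc.separated (j + 2)).mono G3) ((hc.separated (j + 3)).mono G4)
    (mem_Ici.2 (hc.nonneg _)) (mem_Ici.2 (hc.nonneg _)) (mem_Ici.2 (hc.nonneg _))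
    (hc.meets (j + 2)) (hc.meets (j + 3)) (hc.meets (j + 4))
    (hmem _ _ hu'0) (hmem _ _ hz0) (hmem _ _ hv'0) hzuv
  refine ⟨z, hz, 2 * G + 4, hheight, ?_, ?_⟩
  · have hlow : ¬ max (φ z) (t 0) + (2 * (C * κ (t (j + 2 + 1))) + 4) <
        min (t (j + 2)) (t (j + 2 + 1)) := fun hcon => by
      have := hc.lt_of_footParam_lt hX hb (show 0 < j + 2 by omega) hcon
      rw [show j + 2 + 1 = j + 3 from rfl, hz0] at this
      norm_num at this
    have hmin : s₀ < min (t (j + 2)) (t (j + 2 + 1)) :=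
      lt_min (hjgt _ (by omega)) (hjgt _ (by omega))
    have hG3 : C * κ (t (j + 2 + 1)) ≤ G := G3
    rcases max_cases (φ z) (t 0) with ⟨h1, -⟩ | ⟨h1, -⟩
    · linarith [le_max_left (φ u) (t 0)]
    · linarith [le_max_right (φ u) (t 0)]
  · have hup : ¬ max (t (j + 3)) (t (j + 3 + 1)) + (2 * (C * κ (t (j + 3 + 1))) + 4) < φ z :=
      fun hcon => by
        have := hc.lt_of_lt_footParam hX hb hcon
        rw [hz0] at this
        norm_num at this
    have hG4 : C * κ (t (j + 3 + 1)) ≤ G := G4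
    have : max (t (j + 3)) (t (j + 3 + 1)) ≤ s₀ + 5 * G := max_le (by linarith) (by linarith)
    linarith

theorem isKappaContracting (hX : IsCAT0 X) (hκ : IsSublinear κ) (hb : IsGeodesicRay b)
    (hC : 0 < C) (hc : NestedWallChain κ C b h t χ) : IsKappaContracting κ b := by
  obtain ⟨E, hE, hbetween⟩ := hc.exists_between hX hκ hb hC
  have hγ := hb.isClosedGeodesic
  refine ⟨2 * E + 1, by linarith, fun x r hdisj => ?_⟩
  set R := dist (b 0) x with hR
  have hR0 : 0 ≤ R := dist_nonneg
  have hκR := hκ.one_le R hR0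
  have hrx : r ≤ height b (Ici 0) x := by
    by_contra! hcon
    have hmem : b (footParam b (Ici 0) x) ∈ Metric.ball x r := by
      rw [Metric.mem_ball, dist_comm]
      exact hcon
    exact Set.disjoint_left.1 hdisj hmem (mem_image_of_mem _ (hγ.footParam_mem x))
  have hxR : footParam b (Ici 0) x ≤ R := by
    have h1 := hγ.abs_footParam_sub_le hX (b 0) x
    rw [hγ.footParam_apply hX self_mem_Ici, zero_sub, abs_neg] at h1
    exact (le_abs_self _).trans h1
  have key : ∀ y ∈ Metric.ball x r,
      |footParam b (Ici 0) x - footParam b (Ici 0) y| ≤ E * κ R := by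
    intro y hy
    have hxy : dist x y < height b (Ici 0) x := by
      rw [Metric.mem_ball, dist_comm] at hy
      linarith
    -- The distance from `z` to `y` exceeds `W`, hence the height of `z`. Going from `x` to `z` and
    -- then to `b` is thus shorter than `d(x, y)`, against `hxy`.
    have final : ∀ z ∈ seg x y, ∀ W, height b (Ici 0) z ≤ W →
        W < |footParam b (Ici 0) z - footParam b (Ici 0) y| → False := by
      intro z hz W h1 h2
      have h3 := hγ.abs_footParam_sub_le hX z y
      have h4 := hγ.height_le x z
      rw [mem_seg_iff] at hz
      linarith
    by_contra! hcon
    rcases lt_abs.1 hcon with h1 | h1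
    · obtain ⟨z, hz, W, hzW, a1, a2⟩ := hbetween R hR0 y x
        (by have := mul_nonneg hE (show 0 ≤ κ R by linarith); linarith) (by linarith)
      exact final z (seg_comm y x ▸ hz) W hzW (lt_abs.2 (Or.inl (by linarith)))
    · obtain ⟨z, hz, W, hzW, a1, a2⟩ := hbetween R hR0 x y hxR (by linarith)
      exact final z hz W hzW (lt_abs.2 (Or.inr (by linarith)))
  have hfoot : ∀ p ∈ projImage (b '' Ici 0) (Metric.ball x r),
      ∃ y ∈ Metric.ball x r, p = b (footParam b (Ici 0) y) := by
    rintro p ⟨y, hy, hp⟩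
    obtain ⟨s, hs, rfl⟩ := hp.1
    exact ⟨y, hy, by rw [(hγ.footParam_eq_iff hX hs).1 hp]⟩
  have hle : Metric.ediam (projImage (b '' Ici 0) (Metric.ball x r)) ≤
      ENNReal.ofReal (2 * E * κ R) := by
    refine Metric.ediam_le fun p hp q hq => ?_
    obtain ⟨y, hy, rfl⟩ := hfoot p hp
    obtain ⟨y', hy', rfl⟩ := hfoot q hq
    rw [edist_dist, hb _ (hγ.footParam_mem y) _ (hγ.footParam_mem y')]
    refine ENNReal.ofReal_le_ofReal ?_
    have h1 := key y hy
    have h2 := key y' hy'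
    have h3 := abs_sub_le (footParam b (Ici 0) y) (footParam b (Ici 0) x)
      (footParam b (Ici 0) y')
    rw [abs_sub_comm] at h1
    linarith
  refine hle.trans_lt ((ENNReal.ofReal_lt_ofReal_iff ?_).2 ?_)
  · positivity
  · linarith

end NestedWallChain

end

/-! ### The cycle of implications -/

theorem theoremC {X : Type*} [MetricSpace X] (hX : IsCAT0 X)
    (κ : ℝ → ℝ) (hκ : IsSublinear κ) (b : ℝ → X) (hb : IsGeodesicRay b) :
    (IsKappaContracting κ b ↔
      ∃ C : ℝ, 0 < C ∧ ∃ (h : ℕ → Curtain X) (t : ℕ → ℝ), Curtain.IsKappaChain κ C b h t) ∧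
    (IsKappaContracting κ b ↔ Curtain.IsKappaCurtainExcursion κ b) := by
  have h1 : IsKappaContracting κ b → Curtain.IsKappaCurtainExcursion κ b :=
    IsKappaContracting.curtainExcursion hX hκ hb
  have h2 : Curtain.IsKappaCurtainExcursion κ b →
      ∃ C : ℝ, 0 < C ∧ ∃ (h : ℕ → Curtain X) (t : ℕ → ℝ), Curtain.IsKappaChain κ C b h t := by
    rintro ⟨C, hC, h, t, hc, -⟩
    exact ⟨C, hC, h, t, hc⟩
  have h3 : (∃ C : ℝ, 0 < C ∧ ∃ (h : ℕ → Curtain X) (t : ℕ → ℝ),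
      Curtain.IsKappaChain κ C b h t) → IsKappaContracting κ b := by
    rintro ⟨C, hC, h, t, hc⟩
    obtain ⟨χ, hχ⟩ := hc.exists_nestedWallChain hX
    exact hχ.isKappaContracting hX hκ hb hC
  exact ⟨⟨fun h => h2 (h1 h), h3⟩, ⟨h1, fun h => h3 (h2 h)⟩⟩
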